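/- Let $U\subset\mathbb{R}^n$ be open and let $g:U\to\mathbb{R}^n\setminus\{0\}$ be locally Lipschitz and satisfy Jacobi's integrability condition: for all $i,j,k\in\{1,\dots,n\}$, for almost every $x\in U$, \[g_i\left(\frac{\partial g_j}{\partial x_k}-\frac{\partial g_k}{\partial x_j}\right)+g_j\left(\frac{\partial g_k}{\partial x_i}-\frac{\partial g_i}{\partial x_k}\right)+g_k\left(\frac{\partial g_i}{\partial x_j}-\frac{\partial g_j}{\partial x_i}\right)=0.\] A function $u:V\to\mathbb{R}$ is called a normal solution of $\nabla u(x)=\lambda(x)g(x)$ if 1) $V\subset U$ is open; 2) $u$ is locally Lipschitz; 3) every level set of $u$ is an $(n-1)$-dimensional $C^1$ submanifold of $\mathbb{R}^n$ (possibly empty); 4) for every level set $X$ of $u$ and every $x\in X$, $g(x)$ is orthogonal to the tangent space $T_x(X)$; 5) $u$ has no local maximum point and no local minimum point; 6) if $u$ is differentiable at $x\in V$, then $\nabla u(x)\neq 0$. It is called a regular solution if, moreover, $V$ is connected (in particular non-empty) and for every $x\in V$ the function $t\mapsto u(x+tg(x))$ is strictly increasing on some neighborhood of $0$. A function $u$ on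 a convex set $V$ is called quasi-convex if $\{y\in V: u(y)\le r\}$ is convex for every $r\in\mathbb{R}$, i.e. $u((1-t)x+ty)\le\max\{u(x),u(y)\}$ for all $x,y\in V$, $t\in[0,1]$. Then the following three conditions are equivalent. (i) For every $x^*\in U$ there exists an open neighborhood $V\subset U$ of $x^*$ such that for all $x,y\in V$, \[g(x)\cdot y\ge g(x)\cdot x\ \Rightarrow\ g(y)\cdot x\le g(y)\cdot y.\] (ii) For every $x\in U$ and $v\in\mathbb{R}^n$ with $g(x)\cdot v=0$, \[\limsup_{t\downarrow 0}\frac{1}{t}\,v\cdot g(x+tv)\ge 0.\] (iii) For every convex set $V$, every regular solution $u:V\to\mathbb{R}$ is quasi-convex. -/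

import Mathlib

open Set Filter Topology MeasureTheory

namespace TotalDiff

/-- `f` is `C¹` on an arbitrary subset `X` of a Euclidean space: around every point of `X` it
agrees on `X` with a `C¹` map defined on an open ball. -/
def IsC1OnSet {m n : ℕ} (f : EuclideanSpace ℝ (Fin n) → EuclideanSpace ℝ (Fin m))
    (X : Set (EuclideanSpace ℝ (Fin n))) : Prop :=
  ∀ x ∈ X, ∃ r : ℝ, 0 < r ∧
    ∃ F : EuclideanSpace ℝ (Fin n) → EuclideanSpace ℝ (Fin m),
      ContDiffOn ℝ 1 F (Metric.ball x r) ∧ ∀ y ∈ X ∩ Metric.ball x r, F y = f y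

/-- `φ` restricts to a `C¹` diffeomorphism from `A` onto `B`. -/
def IsC1Diffeo {m n : ℕ} (φ : EuclideanSpace ℝ (Fin m) → EuclideanSpace ℝ (Fin n))
    (A : Set (EuclideanSpace ℝ (Fin m))) (B : Set (EuclideanSpace ℝ (Fin n))) : Prop :=
  IsC1OnSet φ A ∧
    ∃ ψ : EuclideanSpace ℝ (Fin n) → EuclideanSpace ℝ (Fin m),
      MapsTo φ A B ∧ MapsTo ψ B A ∧ InvOn ψ φ A B ∧ IsC1OnSet ψ B

/-- `φ : W → X` is a `C¹` local parametrization of `X` around `x`: a `C¹` diffeomorphism from an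
open set `W ⊆ ℝᵐ` onto a relatively open neighbourhood of `x` in `X`. -/
def IsLocalParam {m n : ℕ} (X : Set (EuclideanSpace ℝ (Fin n))) (x : EuclideanSpace ℝ (Fin n))
    (W : Set (EuclideanSpace ℝ (Fin m)))
    (φ : EuclideanSpace ℝ (Fin m) → EuclideanSpace ℝ (Fin n)) : Prop :=
  IsOpen W ∧ ∃ O : Set (EuclideanSpace ℝ (Fin n)), IsOpen O ∧ x ∈ X ∩ O ∧ IsC1Diffeo φ W (X ∩ O)

/-- `X ⊆ ℝⁿ` is an `m`-dimensional `C¹` manifold. -/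
def IsC1Manifold {n : ℕ} (m : ℕ) (X : Set (EuclideanSpace ℝ (Fin n))) : Prop :=
  ∀ x ∈ X, ∃ (W : Set (EuclideanSpace ℝ (Fin m)))
    (φ : EuclideanSpace ℝ (Fin m) → EuclideanSpace ℝ (Fin n)), IsLocalParam X x W φ

/-- The tangent space `T_x(X)` of an `m`-dimensional `C¹` manifold `X ⊆ ℝⁿ`: the vectors in the
range of the derivative, at the preimage of `x`, of a local parametrization around `x` (this range
does not depend on the parametrization). -/
def tangentVectors {n : ℕ} (m : ℕ) (X : Set (EuclideanSpace ℝ (Fin n)))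
    (x : EuclideanSpace ℝ (Fin n)) : Set (EuclideanSpace ℝ (Fin n)) :=
  {v | ∃ (W : Set (EuclideanSpace ℝ (Fin m)))
      (φ : EuclideanSpace ℝ (Fin m) → EuclideanSpace ℝ (Fin n)),
      IsLocalParam X x W φ ∧ ∃ w ∈ W, φ w = x ∧ v ∈ range (fderiv ℝ φ w)}

/-- `g` is a normal vector field of the `m`-dimensional `C¹` manifold `X ⊆ ℝⁿ`. -/
def IsNormalField {n : ℕ} (m : ℕ) (g : EuclideanSpace ℝ (Fin n) → EuclideanSpace ℝ (Fin n))
    (X : Set (EuclideanSpace ℝ (Fin n))) : Prop :=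
  ∀ x ∈ X, ∀ v ∈ tangentVectors m X x, inner ℝ (g x) v = 0

/-- `u : V → ℝ` is a normal solution of `∇u = λ g`, where `g` is a nowhere vanishing vector field
on the open set `U ⊆ ℝⁿ`. Only the values of `u` on `V` and of `g` on `U` matter. -/
structure IsNormalSolution {n : ℕ} (U : Set (EuclideanSpace ℝ (Fin n)))
    (g : EuclideanSpace ℝ (Fin n) → EuclideanSpace ℝ (Fin n))
    (V : Set (EuclideanSpace ℝ (Fin n))) (u : EuclideanSpace ℝ (Fin n) → ℝ) : Prop where
  isOpen : IsOpen V
  subset : V ⊆ U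
  locallyLipschitz : LocallyLipschitzOn V u
  level_manifold : ∀ c : ℝ, IsC1Manifold (n - 1) {x ∈ V | u x = c}
  level_normal : ∀ c : ℝ, IsNormalField (n - 1) g {x ∈ V | u x = c}
  no_localMax : ∀ x ∈ V, ¬ IsLocalMaxOn u V x
  no_localMin : ∀ x ∈ V, ¬ IsLocalMinOn u V x
  gradient_ne_zero : ∀ x ∈ V, DifferentiableAt ℝ u x → gradient u x ≠ 0

/-- A normal solution `u : V → ℝ` is regular if `V` is connected and, for every `x ∈ V`, the
function `t ↦ u (x + t g(x))` is (strictly) increasing around `0`. -/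
structure IsRegularSolution {n : ℕ} (U : Set (EuclideanSpace ℝ (Fin n)))
    (g : EuclideanSpace ℝ (Fin n) → EuclideanSpace ℝ (Fin n))
    (V : Set (EuclideanSpace ℝ (Fin n))) (u : EuclideanSpace ℝ (Fin n) → ℝ) : Prop
    extends IsNormalSolution U g V u where
  isConnected : IsConnected V
  increasing : ∀ x ∈ V, ∃ ε : ℝ, 0 < ε ∧
    (∀ t ∈ Ioo (-ε) ε, x + t • g x ∈ V) ∧
    StrictMonoOn (fun t : ℝ => u (x + t • g x)) (Ioo (-ε) ε)

/-- The partial derivative `∂g_j/∂x_k` at `x`. -/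
noncomputable def partialD {n : ℕ} (g : EuclideanSpace ℝ (Fin n) → EuclideanSpace ℝ (Fin n))
    (j k : Fin n) (x : EuclideanSpace ℝ (Fin n)) : ℝ :=
  lineDeriv ℝ (fun y => g y j) x (EuclideanSpace.single k 1)

/-- Jacobi's integrability condition for `g` on `U`, almost everywhere with respect to Lebesgue
measure (a locally Lipschitz `g` is differentiable almost everywhere). -/
def JacobiCondition {n : ℕ} (U : Set (EuclideanSpace ℝ (Fin n)))
    (g : EuclideanSpace ℝ (Fin n) → EuclideanSpace ℝ (Fin n)) : Prop :=
  ∀ i j k : Fin n, ∀ᵐ x ∂(volume.restrict U),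
    g x i * (partialD g j k x - partialD g k j x)
      + g x j * (partialD g k i x - partialD g i k x)
      + g x k * (partialD g i j x - partialD g j i x) = 0

end TotalDiff

/-!
The implications form a cycle, in which only the last one uses Jacobi's condition.

Near a point of `U`, with `e` the unit vector in the direction of `g` there, the field
`f = -g / ⟪e, g⟫` extends to a bounded Lipschitz field on the whole space with `⟪e, f⟫ = -1`
(`IsSlopeField`, `exists_isSlopeField`). Every segment then has a lift: a curve above it, in
direction `e`, that is orthogonal to `f`. Its height solves a scalar differential equation
(`IsLift`, `transport`).

Local pseudomonotonicity implies the infinitesimal condition because `v ⬝ g (x + t v)` is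
nonnegative for small `t > 0` (`limsup_nonneg_of_local_pseudomonotone`).

A normal solution `u` has derivative zero along every curve orthogonal to `g`, because such a curve
is tangent to a curve in the level set and `u` is Lipschitz. Hence `u` is constant along lifts
(`IsNormalSolution.eq_along_lift`), and a regular solution increases in every direction having
positive inner product with `g` (`IsRegularSolution.eventually_lt`). Suppose that `u` is larger at
some point of a segment than at its end points, and lift the segment from the last point where the
maximum is attained. The infinitesimal condition says that the slope of the lift is nonincreasing,
and it starts out nonpositive; so the lift stays below the segment, where `u` is smaller than on the
segment unless they coincide. As `u` is constant on the lift and maximal at the starting point, the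
two coincide, and the maximum is attained later on: a contradiction
(`IsRegularSolution.exists_eq_of_max`, `IsRegularSolution.quasiconvexOn`).

Conversely, quasi-convexity of a regular solution near a point gives pseudomonotonicity of `g` there
(`IsRegularSolution.inner_le_of_quasiconvexOn`), so it remains to construct a regular solution near
each point (`exists_isRegularSolution`). By Jacobi's condition the curvature of `f` vanishes almost
everywhere, and the curvature of a mollification of `f` is therefore uniformly small
(`IsSlopeField.exists_smooth_approx`). For a smooth field, Grönwall's inequality bounds by the
curvature the amount by which the end points of lifts fail to form a hypersurface orthogonal to the
field; in the limit, the lifts of the segments issuing from a point sweep out a `C¹` leaf orthogonal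
to `f` (`IsSlopeField.hasFDerivAt_transport`). The solution is the height at which the leaf through
a point meets a fixed line in direction `e`.
-/

namespace TotalDiff

open scoped NNReal

/-! ### Lifts of segments and transport along them -/

section Lifts

variable {E : Type*} [NormedAddCommGroup E] [InnerProductSpace ℝ E]

/-- `f` is a globally Lipschitz, bounded slope field transverse to the unit vector `e`: its
component along `e` is `-1`, so that `h + ⟪h, f p⟫ • e` is orthogonal to `f p` for every `h`. -/
structure IsSlopeField (f : E → E) (e : E) (K : ℝ≥0) (M : ℝ) : Prop where
  lipschitz : LipschitzWith K f
  bound : ∀ p, ‖f p‖ ≤ M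
  vertical : ∀ p, inner ℝ e (f p) = -1
  norm_eq_one : ‖e‖ = 1

/-- `w` is the height, along `e`, of the curve `t ↦ b + t • h + w t • e`, `t ∈ [0, 1]`, that lies
above the segment from `b` to `b + h` and is everywhere orthogonal to `f`. -/
def IsLift (f : E → E) (e b h : E) (w : ℝ → ℝ) : Prop :=
  ∀ t ∈ Icc (0 : ℝ) 1,
    HasDerivWithinAt w (inner ℝ h (f (b + t • h + w t • e))) (Icc 0 1) t

variable {f f' : E → E} {e : E} {K : ℝ≥0} {M : ℝ}

theorem IsSlopeField.bound_nonneg (hf : IsSlopeField f e K M) : 0 ≤ M :=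
  (norm_nonneg _).trans (hf.bound 0)

theorem IsLift.continuousOn {b h : E} {w : ℝ → ℝ} (hw : IsLift f e b h w) :
    ContinuousOn w (Icc 0 1) := fun t ht => (hw t ht).continuousWithinAt

theorem IsLift.hasDerivWithinAt_Ici {b h : E} {w : ℝ → ℝ} (hw : IsLift f e b h w) {t : ℝ}
    (ht : t ∈ Ico (0 : ℝ) 1) :
    HasDerivWithinAt w (inner ℝ h (f (b + t • h + w t • e))) (Ici t) t :=
  (hw t ⟨ht.1, ht.2.le⟩).mono_of_mem_nhdsWithin
    (mem_of_superset (Icc_mem_nhdsGE ht.2) (Icc_subset_Icc_left ht.1))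

theorem IsLift.hasDerivWithinAt_curve {b h : E} {w : ℝ → ℝ} (hw : IsLift f e b h w) {t : ℝ}
    (ht : t ∈ Icc (0 : ℝ) 1) : HasDerivWithinAt (fun t => b + t • h + w t • e)
      (h + (inner ℝ h (f (b + t • h + w t • e)) : ℝ) • e) (Icc 0 1) t := by
  have := (((hasDerivWithinAt_id t (Icc (0 : ℝ) 1)).smul_const h).const_add b).fun_add
    ((hw t ht).smul_const e)
  rw [one_smul] at this
  exact this

theorem gronwallBound_le_mul_exp {δ K ε x : ℝ} (hδ : 0 ≤ δ) (hK : 0 ≤ K) (hε : 0 ≤ ε)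
    (hx : x ∈ Icc (0 : ℝ) 1) : gronwallBound δ K ε x ≤ (δ + ε) * Real.exp K := by
  refine (gronwallBound_mono hδ hε hK hx.2).trans ?_
  rcases hK.eq_or_lt with rfl | hK'
  · simp [gronwallBound_K0]
  · rw [gronwallBound_of_K_ne_0 hK'.ne']
    have h1 : Real.exp K - 1 ≤ K * Real.exp K := by
      have h2 := Real.add_one_le_exp (-K)
      have h3 : Real.exp (-K) * Real.exp K = 1 := by rw [← Real.exp_add]; simp
      nlinarith [Real.exp_pos K]
    have h4 : ε / K * (Real.exp K - 1) ≤ ε / K * (K * Real.exp K) := by gcongr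
    have h5 : ε / K * (K * Real.exp K) = ε * Real.exp K := by field_simp
    simp only [mul_one]
    linarith

theorem lipschitzWith_inner_line (hf : LipschitzWith K f) (he : ‖e‖ = 1) (b h : E) :
    LipschitzWith (‖h‖₊ * K) fun x : ℝ => inner ℝ h (f (b + x • e)) := by
  refine LipschitzWith.of_dist_le_mul fun x y => ?_
  rw [Real.dist_eq, ← inner_sub_right]
  refine (abs_real_inner_le_norm _ _).trans ?_
  have := hf.dist_le_mul (b + x • e) (b + y • e)
  rw [dist_eq_norm, dist_eq_norm, add_sub_add_left_eq_sub, ← sub_smul, norm_smul, he, mul_one,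
    Real.norm_eq_abs, ← Real.dist_eq] at this
  push_cast
  rw [mul_assoc]
  gcongr

/-- Grönwall's inequality for lifts of two nearby segments in two nearby slope fields. -/
theorem IsLift.abs_sub_le {b b' h h' : E} {w w' : ℝ → ℝ} {ε : ℝ} (hf : LipschitzWith K f)
    (he : ‖e‖ = 1) (hM : ∀ p, ‖f' p‖ ≤ M) (hε : ∀ p, ‖f' p - f p‖ ≤ ε)
    (hw : IsLift f e b h w) (hw' : IsLift f' e b' h' w') {t : ℝ} (ht : t ∈ Icc (0 : ℝ) 1) :
    |w t - w' t| ≤ (|w 0 - w' 0| + (‖h' - h‖ * M + ‖h‖ * (ε + K * (‖b' - b‖ + ‖h' - h‖)))) *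
      Real.exp (‖h‖ * K) := by
  have hM0 : 0 ≤ M := (norm_nonneg _).trans (hM 0)
  have hε0 : 0 ≤ ε := (norm_nonneg _).trans (hε 0)
  have key := dist_le_of_approx_trajectories_ODE
    (v := fun (t x : ℝ) => (inner ℝ h (f (b + t • h + x • e)) : ℝ)) (K := ‖h‖₊ * K)
    (fun t => lipschitzWith_inner_line hf he (b + t • h) h) (εf := 0)
    (εg := ‖h' - h‖ * M + ‖h‖ * (ε + K * (‖b' - b‖ + ‖h' - h‖))) (δ := |w 0 - w' 0|)
    hw.continuousOn
    (fun t ht => hw.hasDerivWithinAt_Ici ht) (fun t ht => by simp)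
    hw'.continuousOn (fun t ht => hw'.hasDerivWithinAt_Ici ht) (fun s hs => ?_)
    (by rw [Real.dist_eq]) t ht
  · rw [Real.dist_eq] at key
    refine key.trans ((gronwallBound_le_mul_exp (abs_nonneg _) (by positivity) (by positivity)
      (by simpa using ht)).trans_eq ?_)
    simp
  · rw [Real.dist_eq]
    set q' := b' + s • h' + w' s • e
    set q := b + s • h + w' s • e
    have e1 : inner ℝ h' (f' q') - inner ℝ h (f q)
        = inner ℝ (h' - h) (f' q') + inner ℝ h ((f' q' - f q') + (f q' - f q)) := by
      simp only [inner_sub_left, inner_sub_right, inner_add_right]; ring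
    have e2 : ‖f q' - f q‖ ≤ K * (‖b' - b‖ + ‖h' - h‖) := by
      rw [← dist_eq_norm]
      refine (hf.dist_le_mul q' q).trans ?_
      have : q' - q = (b' - b) + s • (h' - h) := by simp only [q, q', smul_sub]; abel
      rw [dist_eq_norm, this]
      gcongr
      refine (norm_add_le _ _).trans ?_
      gcongr
      rw [norm_smul, Real.norm_of_nonneg hs.1]
      exact mul_le_of_le_one_left (norm_nonneg _) hs.2.le
    rw [e1]
    refine (abs_add_le _ _).trans (add_le_add ?_ ?_)
    · refine (abs_real_inner_le_norm _ _).trans ?_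
      gcongr
      exact hM _
    · refine (abs_real_inner_le_norm _ _).trans ?_
      gcongr
      exact (norm_add_le _ _).trans (add_le_add (hε _) e2)

theorem IsLift.eqOn (hf : IsSlopeField f e K M) {b h : E} {w w' : ℝ → ℝ}
    (hw : IsLift f e b h w) (hw' : IsLift f e b h w') (h0 : w 0 = w' 0) {t : ℝ}
    (ht : t ∈ Icc (0 : ℝ) 1) : w t = w' t := by
  have := hw.abs_sub_le (ε := 0) hf.lipschitz hf.norm_eq_one hf.bound (by simp) hw' ht
  simp only [h0, sub_self, norm_zero, abs_zero] at this
  simpa [sub_eq_zero] using this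

theorem IsLift.abs_sub_initial_le (hM : ∀ p, ‖f p‖ ≤ M) {b h : E} {w : ℝ → ℝ}
    (hw : IsLift f e b h w) {t : ℝ} (ht : t ∈ Icc (0 : ℝ) 1) : |w t - w 0| ≤ ‖h‖ * M := by
  have hM0 : 0 ≤ M := (norm_nonneg _).trans (hM 0)
  have := norm_image_sub_le_of_norm_deriv_right_le_segment hw.continuousOn
    (fun t ht => hw.hasDerivWithinAt_Ici ht) (C := ‖h‖ * M)
    (fun t _ => (abs_real_inner_le_norm _ _).trans (by gcongr; exact hM _)) t ht
  rw [Real.norm_eq_abs] at this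
  refine this.trans (mul_le_of_le_one_right (by positivity) (by linarith [ht.2]))

theorem exists_isLift (hf : LipschitzWith K f) (he : ‖e‖ = 1) (hM : ∀ p, ‖f p‖ ≤ M) (b h : E)
    (c : ℝ) : ∃ w : ℝ → ℝ, w 0 = c ∧ IsLift f e b h w := by
  have hM0 : 0 ≤ M := (norm_nonneg _).trans (hM 0)
  have hP : IsPicardLindelof (fun (t x : ℝ) => (inner ℝ h (f (b + t • h + x • e)) : ℝ))
      (⟨0, by simp⟩ : Icc (0 : ℝ) 1) c (‖h‖₊ * M.toNNReal) 0 (‖h‖₊ * M.toNNReal) (‖h‖₊ * K) :=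
    { lipschitzOnWith := fun t _ => (lipschitzWith_inner_line hf he (b + t • h) h).lipschitzOnWith
      continuousOn := fun x _ => by
        have := hf.continuous
        fun_prop
      norm_le := fun t _ x _ => (abs_real_inner_le_norm _ _).trans (by
        rw [NNReal.coe_mul, coe_nnnorm, Real.coe_toNNReal _ hM0]
        gcongr
        exact hM _)
      mul_max_le := by simp }
  exact hP.exists_eq_forall_mem_Icc_hasDerivWithinAt₀

/-- The height at which the lift of the segment from `b` to `b + h` that starts at height `c`
above `b` arrives above `b + h`. -/
noncomputable def transport (f : E → E) (e b h : E) (c : ℝ) : ℝ :=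
  Classical.epsilon (fun w : ℝ → ℝ => w 0 = c ∧ IsLift f e b h w) 1

theorem IsSlopeField.exists_lift (hf : IsSlopeField f e K M) (b h : E) (c : ℝ) :
    ∃ w : ℝ → ℝ, w 0 = c ∧ w 1 = transport f e b h c ∧ IsLift f e b h w := by
  have := Classical.epsilon_spec (exists_isLift hf.lipschitz hf.norm_eq_one hf.bound b h c)
  exact ⟨_, this.1, rfl, this.2⟩

theorem IsLift.transport_eq (hf : IsSlopeField f e K M) {b h : E} {w : ℝ → ℝ}
    (hw : IsLift f e b h w) : transport f e b h (w 0) = w 1 := by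
  obtain ⟨v, h0, h1, hv⟩ := hf.exists_lift b h (w 0)
  rw [← h1]
  exact hv.eqOn hf hw h0 (by simp)

/-- Going back along the reversed segment returns to the initial height. -/
theorem IsSlopeField.transport_reverse (hf : IsSlopeField f e K M) (b h : E) (c : ℝ) :
    transport f e (b + h) (-h) (transport f e b h c) = c := by
  obtain ⟨w, h0, h1, hw⟩ := hf.exists_lift b h c
  have hv : IsLift f e (b + h) (-h) (fun t => w (1 - t)) := by
    intro t ht
    have ht' : 1 - t ∈ Icc (0 : ℝ) 1 := ⟨by linarith [ht.2], by linarith [ht.1]⟩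
    have hd : HasDerivWithinAt (fun s : ℝ => 1 - s) (-1) (Icc 0 1) t := by
      simpa using (hasDerivWithinAt_id t (Icc (0 : ℝ) 1)).const_sub 1
    have := (hw _ ht').scomp t hd
      (fun s hs => ⟨by linarith [hs.2], by linarith [hs.1]⟩)
    convert! this using 1
    rw [inner_neg_left, neg_smul, one_smul]
    congr 4
    module
  have := hv.transport_eq hf
  simp only [sub_zero, sub_self] at this
  rw [← h1, this, h0]

theorem IsSlopeField.transport_reverse' (hf : IsSlopeField f e K M) (b h : E) (c : ℝ) :
    transport f e b h (transport f e (b + h) (-h) c) = c := by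
  have := hf.transport_reverse (b + h) (-h) c
  rwa [add_neg_cancel_right, neg_neg] at this

theorem IsSlopeField.strictMono_transport (hf : IsSlopeField f e K M) (b h : E) :
    StrictMono (transport f e b h) := by
  intro c c' hc
  by_contra! hle
  obtain ⟨w, h0, h1, hw⟩ := hf.exists_lift b h c
  obtain ⟨w', h0', h1', hw'⟩ := hf.exists_lift b h c'
  have hcont : ContinuousOn (fun t => w t - w' t) (Icc 0 1) :=
    hw.continuousOn.sub hw'.continuousOn
  obtain ⟨t, ht, hzero⟩ : (0 : ℝ) ∈ (fun t => w t - w' t) '' Icc 0 1 :=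
    intermediate_value_Icc zero_le_one hcont
      ⟨by simp only [h0, h0']; linarith, by simp only [h1, h1']; linarith⟩
  -- rescaled to `[0, 1]`, the restrictions to `[0, t]` are lifts of the same segment with the same
  -- end point, hence with the same initial point
  have hb := fun (v : ℝ → ℝ) (hv : IsLift f e b h v) =>
    show IsLift f e b (t • h) (fun s => v (t * s)) from fun s hs => by
      have hts : t * s ∈ Icc (0 : ℝ) 1 :=
        ⟨mul_nonneg ht.1 hs.1, mul_le_one₀ ht.2 hs.1 hs.2⟩
      have hd : HasDerivWithinAt (fun s : ℝ => t * s) t (Icc 0 1) s := by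
        simpa using (hasDerivWithinAt_id s (Icc (0 : ℝ) 1)).const_mul t
      have := (hv _ hts).scomp s hd
        (fun r hr => ⟨mul_nonneg ht.1 hr.1, mul_le_one₀ ht.2 hr.1 hr.2⟩)
      convert! this using 1
      rw [inner_smul_left, smul_smul, mul_comm s t]
      simp
  have e1 := (hb w hw).transport_eq hf
  have e2 := (hb w' hw').transport_eq hf
  simp only [mul_zero, mul_one, h0, h0'] at e1 e2
  have : c = c' := by
    rw [← hf.transport_reverse b (t • h) c, ← hf.transport_reverse b (t • h) c', e1, e2,
      sub_eq_zero.1 hzero]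
  exact absurd this hc.ne

/-- Since `f` has component `-1` along `e`, moving the end point of the segment along `e` does not
move the end point of its lift. -/
theorem IsSlopeField.transport_add_smul (hf : IsSlopeField f e K M) (b h : E) (k c : ℝ) :
    transport f e b (h + k • e) c = transport f e b h c - k := by
  obtain ⟨w, h0, h1, hw⟩ := hf.exists_lift b h c
  have hv : IsLift f e b (h + k • e) (fun t => w t - k * t) := by
    intro t ht
    have := (hw t ht).sub ((hasDerivWithinAt_id t (Icc (0 : ℝ) 1)).const_mul k)
    convert! this using 1
    have e1 : b + t • (h + k • e) + (w t - k * t) • e = b + t • h + w t • e := by module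
    rw [e1, inner_add_left, inner_smul_left, hf.vertical]
    simp
    ring
  have := hv.transport_eq hf
  simp only [mul_zero, sub_zero, mul_one, h0, h1] at this
  exact this

theorem IsSlopeField.abs_transport_sub_le (hf : IsSlopeField f e K M) (b h : E) (c : ℝ) :
    |transport f e b h c - c| ≤ ‖h‖ * M := by
  obtain ⟨w, h0, h1, hw⟩ := hf.exists_lift b h c
  have := hw.abs_sub_initial_le hf.bound (t := 1) (by simp)
  rwa [h0, h1] at this

theorem IsSlopeField.abs_transport_sub_transport_le (hf : IsSlopeField f e K M) (b b' h h' : E)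
    (c c' : ℝ) : |transport f e b h c - transport f e b' h' c'| ≤
      (|c - c'| + (‖h' - h‖ * M + ‖h‖ * (K * (‖b' - b‖ + ‖h' - h‖)))) * Real.exp (‖h‖ * K) := by
  obtain ⟨w, h0, h1, hw⟩ := hf.exists_lift b h c
  obtain ⟨w', h0', h1', hw'⟩ := hf.exists_lift b' h' c'
  have := hw.abs_sub_le (ε := 0) hf.lipschitz hf.norm_eq_one hf.bound (by simp) hw'
    (t := 1) (by simp)
  rwa [h0, h1, h0', h1', zero_add] at this

theorem IsSlopeField.continuous_transport (hf : IsSlopeField f e K M) (b : E) :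
    Continuous fun x : E × ℝ => transport f e b x.1 x.2 := by
  refine continuous_iff_continuousAt.2 fun x => ?_
  rw [ContinuousAt, tendsto_iff_dist_tendsto_zero]
  refine squeeze_zero (fun _ => dist_nonneg) (fun y => ?_)
    (g := fun y : E × ℝ => (|x.2 - y.2| + (‖y.1 - x.1‖ * M + ‖x.1‖ * (K * (‖b - b‖ + ‖y.1 - x.1‖))))
      * Real.exp (‖x.1‖ * K)) ?_
  · rw [dist_comm, Real.dist_eq]
    exact hf.abs_transport_sub_transport_le b b x.1 y.1 x.2 y.2
  · have : Continuous fun y : E × ℝ => (|x.2 - y.2| + (‖y.1 - x.1‖ * M +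
        ‖x.1‖ * (K * (‖b - b‖ + ‖y.1 - x.1‖)))) * Real.exp (‖x.1‖ * K) := by fun_prop
    simpa using this.tendsto x

end Lifts

/-! ### Slope fields associated with a vector field -/

section LocalSlope

variable {E : Type*} [NormedAddCommGroup E] [InnerProductSpace ℝ E]

theorem exists_lipschitzWith_inv_smul {a : E → E} {b : E → ℝ} {A B : ℝ≥0} {m C : ℝ}
    (ha : LipschitzWith A a) (hb : LipschitzWith B b) (hm : 0 < m) (hbm : ∀ p, m ≤ b p)
    (hC : ∀ p, ‖a p‖ ≤ C * b p) : ∃ L : ℝ≥0, LipschitzWith L fun p => (b p)⁻¹ • a p := by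
  have hC0 : 0 ≤ C := by
    by_contra! h
    have := (norm_nonneg (a 0)).trans (hC 0)
    nlinarith [hbm 0]
  refine ⟨((A + C * B) / m).toNNReal, LipschitzWith.of_dist_le_mul fun p q => ?_⟩
  have hp : 0 < b p := hm.trans_le (hbm p)
  have hq : 0 < b q := hm.trans_le (hbm q)
  rw [Real.coe_toNNReal _ (by positivity), dist_eq_norm]
  have e1 : (b p)⁻¹ • a p - (b q)⁻¹ • a q
      = (b p)⁻¹ • (a p - a q) + ((b p)⁻¹ * (b q)⁻¹ * (b q - b p)) • a q := by
    have : (b p)⁻¹ * (b q)⁻¹ * (b q - b p) = (b p)⁻¹ - (b q)⁻¹ := by field_simp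
    rw [this]
    module
  rw [e1]
  refine (norm_add_le _ _).trans ?_
  have hpm : (b p)⁻¹ ≤ m⁻¹ := inv_anti₀ hm (hbm p)
  have h1 : ‖(b p)⁻¹ • (a p - a q)‖ ≤ m⁻¹ * (A * dist p q) := by
    rw [norm_smul, Real.norm_of_nonneg (by positivity), ← dist_eq_norm]
    gcongr
    exact ha.dist_le_mul p q
  have h2 : ‖((b p)⁻¹ * (b q)⁻¹ * (b q - b p)) • a q‖ ≤ m⁻¹ * (C * (B * dist p q)) := by
    rw [norm_smul, norm_mul, norm_mul, Real.norm_of_nonneg (inv_nonneg.2 hp.le),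
      Real.norm_of_nonneg (inv_nonneg.2 hq.le), Real.norm_eq_abs, abs_sub_comm, ← Real.dist_eq]
    calc (b p)⁻¹ * (b q)⁻¹ * dist (b p) (b q) * ‖a q‖
        ≤ m⁻¹ * (b q)⁻¹ * (B * dist p q) * (C * b q) := by
          gcongr
          · exact hb.dist_le_mul p q
          · exact hC q
      _ = _ := by field_simp
  calc _ ≤ _ := add_le_add h1 h2
    _ = _ := by ring

/-- Near a point where a locally Lipschitz field `g` does not vanish, the direction orthogonal to
`g` is the one orthogonal to a globally defined slope field. -/
theorem exists_isSlopeField [FiniteDimensional ℝ E] {U : Set E} (hU : IsOpen U) {g : E → E}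
    (hg : LocallyLipschitzOn U g) {x : E} (hx : x ∈ U) (hgx : g x ≠ 0) :
    ∃ (f : E → E) (e : E) (K : ℝ≥0) (M r m : ℝ), IsSlopeField f e K M ∧ g x = ‖g x‖ • e ∧
      0 < r ∧ 0 < m ∧ Metric.ball x r ⊆ U ∧ ∀ p ∈ Metric.ball x r,
        m ≤ inner ℝ e (g p) ∧ f p = -(inner ℝ e (g p))⁻¹ • g p := by
  obtain ⟨L, t, ht, hL⟩ := hg hx
  rw [hU.nhdsWithin_eq hx] at ht
  obtain ⟨G, hG, hGg⟩ := hL.extend_finite_dimension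
  have hxt : x ∈ t := mem_of_mem_nhds ht
  have hnorm : 0 < ‖g x‖ := norm_pos_iff.2 hgx
  set e : E := ‖g x‖⁻¹ • g x with he_def
  have he : ‖e‖ = 1 := by
    rw [he_def, norm_smul, norm_inv, norm_norm, inv_mul_cancel₀ hnorm.ne']
  have hge : g x = ‖g x‖ • e := by rw [he_def, smul_inv_smul₀ hnorm.ne']
  have heg : inner ℝ e (G x) = ‖g x‖ := by
    rw [← hGg hxt, hge, inner_smul_right, real_inner_self_eq_norm_sq, he, norm_smul, he]
    simp
  set m : ℝ := ‖g x‖ / 2 with hm_def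
  have hm : 0 < m := by positivity
  -- this denominator is `⟪e, g p⟫` near `x`, and keeps the quotient Lipschitz and bounded elsewhere
  set b : E → ℝ := fun p => max (max m (inner ℝ e (G p))) (‖G p‖ / 2) with hb_def
  have hin : LipschitzWith (lipschitzExtensionConstant E * L) fun p => inner ℝ e (G p) := by
    refine LipschitzWith.of_dist_le_mul fun p q => ?_
    rw [Real.dist_eq, ← inner_sub_right]
    refine (abs_real_inner_le_norm _ _).trans ?_
    rw [he, one_mul, ← dist_eq_norm]
    exact hG.dist_le_mul p q
  have hno : LipschitzWith (lipschitzExtensionConstant E * L) fun p => ‖G p‖ / 2 := by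
    refine LipschitzWith.of_dist_le_mul fun p q => ?_
    have h1 := abs_norm_sub_norm_le (G p) (G q)
    have h2 := hG.dist_le_mul p q
    rw [dist_eq_norm] at h2
    rw [Real.dist_eq, ← sub_div, abs_div, abs_two]
    linarith [abs_nonneg (‖G p‖ - ‖G q‖)]
  obtain ⟨B, hB⟩ : ∃ B : ℝ≥0, LipschitzWith B b :=
    ⟨_, ((LipschitzWith.const' m (K := 0)).max hin).max hno⟩
  have hbm : ∀ p, m ≤ b p := fun p => (le_max_left _ _).trans (le_max_left _ _)
  have hGb : ∀ p, ‖G p‖ ≤ 2 * b p := fun p => by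
    have : ‖G p‖ / 2 ≤ b p := le_max_right _ _
    linarith
  obtain ⟨Q, hQ⟩ := exists_lipschitzWith_inv_smul hG hB hm hbm hGb
  set f₀ : E → E := fun p => -((b p)⁻¹ • G p) with hf₀
  have hf₀L : LipschitzWith Q f₀ := hQ.neg
  have hf₀b : ∀ p, ‖f₀ p‖ ≤ 2 := fun p => by
    have hp : 0 < b p := hm.trans_le (hbm p)
    rw [hf₀, norm_neg, norm_smul, norm_inv, Real.norm_of_nonneg hp.le, inv_mul_le_iff₀ hp, mul_comm]
    exact hGb p
  set f : E → E := fun p => f₀ p - (inner ℝ e (f₀ p) + 1) • e with hf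
  have hslope : IsSlopeField f e (Q + Q) 5 := by
    refine ⟨?_, fun p => ?_, fun p => ?_, he⟩
    · refine hf₀L.sub (LipschitzWith.of_dist_le_mul fun p q => ?_)
      rw [dist_eq_norm, ← sub_smul, norm_smul, he, mul_one, add_sub_add_right_eq_sub,
        ← inner_sub_right]
      refine (norm_inner_le_norm _ _).trans ?_
      rw [he, one_mul, ← dist_eq_norm]
      exact hf₀L.dist_le_mul p q
    · have h1 : ‖inner ℝ e (f₀ p)‖ ≤ 2 := (norm_inner_le_norm _ _).trans (by
        rw [he, one_mul]; exact hf₀b p)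
      have h2 := norm_add_le (inner ℝ e (f₀ p)) (1 : ℝ)
      have h3 := norm_sub_le (f₀ p) ((inner ℝ e (f₀ p) + 1) • e)
      rw [norm_smul, he, mul_one] at h3
      rw [norm_one] at h2
      linarith [hf₀b p]
    · rw [hf, inner_sub_right, inner_smul_right, real_inner_self_eq_norm_sq, he]
      ring
  have hcont : Continuous fun p => inner ℝ e (G p) := hin.continuous
  have h1 : ∀ᶠ p in 𝓝 x, m < inner ℝ e (G p) :=
    hcont.continuousAt.eventually_const_lt (by simp only [heg]; linarith)
  have h2 : ∀ᶠ p in 𝓝 x, ‖G p‖ / 2 < inner ℝ e (G p) := by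
    refine ContinuousAt.eventually_lt hno.continuous.continuousAt hcont.continuousAt ?_
    rw [heg, ← hGg hxt]
    linarith
  obtain ⟨r, hr, hball⟩ := Metric.eventually_nhds_iff_ball.1
    (((h1.and h2).and ht).and (hU.mem_nhds hx))
  refine ⟨f, e, Q + Q, 5, r, m, hslope, hge, hr, hm, fun p hp => (hball p hp).2, fun p hp => ?_⟩
  obtain ⟨⟨⟨h1, h2⟩, h3⟩, -⟩ := hball p hp
  have hbp : b p = inner ℝ e (g p) := by
    rw [hb_def, hGg h3]
    simp only
    rw [max_eq_right h1.le, max_eq_left h2.le]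
  rw [hGg h3]
  refine ⟨h1.le, ?_⟩
  have hne : inner ℝ e (G p) ≠ 0 := (hm.trans h1).ne'
  rw [hf, hf₀]
  simp only
  rw [hbp, hGg h3, inner_neg_right, inner_smul_right, inv_mul_cancel₀ hne]
  simp

/-- Lifted vectors are orthogonal to `g` wherever `f` is proportional to `g`. -/
theorem inner_lift_eq_zero {e y z : E} (hy : inner ℝ e y ≠ 0) (hz : z = -(inner ℝ e y)⁻¹ • y)
    (h : E) : inner ℝ y (h + (inner ℝ h z : ℝ) • e) = 0 := by
  rw [hz, inner_add_right, inner_smul_right, inner_smul_right, real_inner_comm e y,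
    real_inner_comm y h]
  field_simp
  ring

end LocalSlope

/-! ### Normal solutions along curves orthogonal to the field -/

section NormalSolution

variable {n : ℕ}

local notation "𝔼" => EuclideanSpace ℝ (Fin n)

theorem IsC1OnSet.exists_differentiableAt {m k : ℕ}
    {f : EuclideanSpace ℝ (Fin k) → EuclideanSpace ℝ (Fin m)} {X : Set (EuclideanSpace ℝ (Fin k))}
    (hf : IsC1OnSet f X) {x : EuclideanSpace ℝ (Fin k)} (hx : x ∈ X) :
    ∃ F : EuclideanSpace ℝ (Fin k) → EuclideanSpace ℝ (Fin m), DifferentiableAt ℝ F x ∧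
      ∀ᶠ y in 𝓝 x, y ∈ X → F y = f y := by
  obtain ⟨r, hr, F, hF, hFf⟩ := hf x hx
  refine ⟨F, (hF.differentiableOn one_ne_zero).differentiableAt (Metric.ball_mem_nhds x hr), ?_⟩
  filter_upwards [Metric.ball_mem_nhds x hr] with y hy hyX using hFf y ⟨hyX, hy⟩

theorem IsC1OnSet.differentiableAt {m k : ℕ}
    {f : EuclideanSpace ℝ (Fin k) → EuclideanSpace ℝ (Fin m)} {X : Set (EuclideanSpace ℝ (Fin k))}
    (hf : IsC1OnSet f X) {x : EuclideanSpace ℝ (Fin k)} (hX : X ∈ 𝓝 x) :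
    DifferentiableAt ℝ f x := by
  obtain ⟨F, hF, hFf⟩ := hf.exists_differentiableAt (mem_of_mem_nhds hX)
  refine hF.congr_of_eventuallyEq ?_
  filter_upwards [hFf, hX] with y hy hyX using (hy hyX).symm

/-- A hypersurface with normal field `g` contains curves through each of its points in all
directions orthogonal to `g`: an inclusion of spaces of the same dimension is an equality. -/
theorem exists_curve_of_inner_eq_zero {X : Set 𝔼} {g : 𝔼 → 𝔼} (hX : IsC1Manifold (n - 1) X)
    (hg : IsNormalField (n - 1) g X) {x : 𝔼} (hx : x ∈ X) (hgx : g x ≠ 0) {v : 𝔼}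
    (hv : inner ℝ (g x) v = 0) :
    ∃ σ : ℝ → 𝔼, σ 0 = x ∧ HasDerivAt σ v 0 ∧ ∀ᶠ t in 𝓝 0, σ t ∈ X := by
  obtain ⟨W, φ, hφ⟩ := hX x hx
  obtain ⟨hW, O, hO, hxO, hφ1, ψ, hmφ, hmψ, hinv, hψ1⟩ := id hφ
  set w := ψ x with hw_def
  have hw : w ∈ W := hmψ hxO
  have hφw : φ w = x := hinv.2 hxO
  have hφd : DifferentiableAt ℝ φ w := hφ1.differentiableAt (hW.mem_nhds hw)
  obtain ⟨Ψ, hΨ, hΨψ⟩ := hψ1.exists_differentiableAt hxO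
  rw [← hφw] at hΨ hΨψ
  have hcomp : (fderiv ℝ Ψ (φ w)).comp (fderiv ℝ φ w) = ContinuousLinearMap.id ℝ _ := by
    have h1 := hΨ.hasFDerivAt.comp w hφd.hasFDerivAt
    refine h1.unique ((hasFDerivAt_id w).congr_of_eventuallyEq ?_)
    filter_upwards [hφd.continuousAt.eventually hΨψ, hW.mem_nhds hw] with y hy hyW
    rw [Function.comp_apply, hy (hmφ hyW), hinv.1 hyW, id]
  have hinj : Function.Injective (fderiv ℝ φ w) := by
    intro a b hab
    have := congrArg (fderiv ℝ Ψ (φ w)) hab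
    simpa [← ContinuousLinearMap.comp_apply, hcomp] using this
  have hrange : LinearMap.range (fderiv ℝ φ w : EuclideanSpace ℝ (Fin (n - 1)) →ₗ[ℝ] 𝔼)
      = (ℝ ∙ g x)ᗮ := by
    refine Submodule.eq_of_le_of_finrank_eq ?_ ?_
    · rintro _ ⟨a, rfl⟩
      rw [Submodule.mem_orthogonal_singleton_iff_inner_right]
      exact hg x hx _ ⟨W, φ, hφ, w, hw, hφw, a, rfl⟩
    · rw [LinearMap.finrank_range_of_inj hinj, finrank_euclideanSpace_fin]
      have := Submodule.finrank_add_finrank_orthogonal (ℝ ∙ g x)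
      rw [finrank_span_singleton hgx, finrank_euclideanSpace_fin] at this
      omega
  have hvr : v ∈ (ℝ ∙ g x)ᗮ := Submodule.mem_orthogonal_singleton_iff_inner_right.2 hv
  rw [← hrange] at hvr
  obtain ⟨a, ha⟩ := hvr
  have hline : HasDerivAt (fun t : ℝ => w + t • a) a 0 := by
    simpa using ((hasDerivAt_id (0 : ℝ)).smul_const a).const_add w
  refine ⟨fun t => φ (w + t • a), by simp [hφw], ?_, ?_⟩
  · have hφd' : HasFDerivAt φ (fderiv ℝ φ w) (w + (0 : ℝ) • a) := by
      simpa using hφd.hasFDerivAt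
    have := hφd'.comp_hasDerivAt 0 hline
    rwa [show (fderiv ℝ φ w) a = v from ha] at this
  · have : Tendsto (fun t : ℝ => w + t • a) (𝓝 0) (𝓝 w) := by
      simpa using hline.continuousAt.tendsto
    filter_upwards [this.eventually (hW.mem_nhds hw)] with t ht using (hmφ ht).1

variable {U V : Set (EuclideanSpace ℝ (Fin n))}
  {g : EuclideanSpace ℝ (Fin n) → EuclideanSpace ℝ (Fin n)} {u : EuclideanSpace ℝ (Fin n) → ℝ}

/-- A normal solution has derivative zero along every curve that is orthogonal to `g`, because the
curve is tangent to a curve inside the level set and `u` is Lipschitz. -/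
theorem IsNormalSolution.hasDerivWithinAt_comp (hu : IsNormalSolution U g V u) {γ : ℝ → 𝔼} {v : 𝔼}
    {s : Set ℝ} {t₀ : ℝ} (hγ : HasDerivWithinAt γ v s t₀) (hp : γ t₀ ∈ V) (hgp : g (γ t₀) ≠ 0)
    (hv : inner ℝ (g (γ t₀)) v = 0) : HasDerivWithinAt (fun t => u (γ t)) 0 s t₀ := by
  obtain ⟨σ, hσ0, hσ, hσX⟩ := exists_curve_of_inner_eq_zero (hu.level_manifold (u (γ t₀)))
    (hu.level_normal _) ⟨hp, rfl⟩ hgp hv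
  obtain ⟨L, N, hN, hL⟩ := hu.locallyLipschitz hp
  rw [hu.isOpen.nhdsWithin_eq hp] at hN
  have hsub : Tendsto (fun t => t - t₀) (𝓝[s] t₀) (𝓝 0) := by
    have : Tendsto (fun t : ℝ => t - t₀) (𝓝 t₀) (𝓝 (t₀ - t₀)) :=
      (continuous_id.sub continuous_const).tendsto t₀
    rw [sub_self] at this
    exact this.mono_left nhdsWithin_le_nhds
  have hσ' : HasDerivWithinAt (fun t => σ (t - t₀)) v s t₀ := by
    have h0 : HasDerivAt σ v (t₀ - t₀) := by rwa [sub_self]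
    exact (h0.comp_sub_const t₀ t₀).hasDerivWithinAt
  have hdiff := (hγ.sub hσ').isLittleO
  refine HasDerivWithinAt.of_isLittleO ?_
  refine Asymptotics.IsBigO.trans_isLittleO ?_ hdiff
  refine Asymptotics.IsBigO.of_bound L ?_
  have hσN : ∀ᶠ t in 𝓝[s] t₀, σ (t - t₀) ∈ N := by
    have : Tendsto σ (𝓝 0) (𝓝 (γ t₀)) := hσ0 ▸ hσ.continuousAt.tendsto
    exact (this.comp hsub).eventually hN
  filter_upwards [hγ.continuousWithinAt.eventually hN, hσN, hsub.eventually hσX] with t h1 h2 h3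
  have h4 := hL.dist_le_mul _ h1 _ h2
  rw [h3.2, dist_eq_norm, dist_eq_norm] at h4
  simpa [hσ0] using h4

/-- A normal solution is constant along lifts. -/
theorem IsNormalSolution.eq_along_lift (hu : IsNormalSolution U g V u) {f : 𝔼 → 𝔼} {e b h : 𝔼}
    {w : ℝ → ℝ} (hw : IsLift f e b h w)
    (hmem : ∀ t ∈ Icc (0 : ℝ) 1, b + t • h + w t • e ∈ V ∧
      0 < inner ℝ e (g (b + t • h + w t • e)) ∧ f (b + t • h + w t • e) =
        -(inner ℝ e (g (b + t • h + w t • e)))⁻¹ • g (b + t • h + w t • e)) :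
    u (b + h + w 1 • e) = u (b + w 0 • e) := by
  have hd : ∀ t ∈ Icc (0 : ℝ) 1, HasDerivWithinAt (fun t => u (b + t • h + w t • e)) 0
      (Icc 0 1) t := by
    intro t ht
    obtain ⟨h1, h2, h3⟩ := hmem t ht
    have hγ :=  hw.hasDerivWithinAt_curve ht
    refine hu.hasDerivWithinAt_comp hγ h1 ?_ (inner_lift_eq_zero h2.ne' h3 h)
    intro h0
    rw [h0, inner_zero_right] at h2
    exact h2.ne rfl
  have := constant_of_has_deriv_right_zero (fun t ht => (hd t ht).continuousWithinAt)
    (fun t ht => (hd t ⟨ht.1, ht.2.le⟩).mono_of_mem_nhdsWithin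
      (mem_of_superset (Icc_mem_nhdsGE ht.2) (Icc_subset_Icc_left ht.1))) 1 (by simp)
  simpa using this

theorem tendsto_sub_nhdsGT (t : ℝ) : Tendsto (fun y : ℝ => y - t) (𝓝[>] t) (𝓝[>] 0) := by
  refine tendsto_nhdsWithin_of_tendsto_nhds_of_eventually_within _ ?_ ?_
  · have : Tendsto (fun y : ℝ => y - t) (𝓝 t) (𝓝 (t - t)) :=
      (continuous_id.sub continuous_const).tendsto t
    rw [sub_self] at this
    exact this.mono_left nhdsWithin_le_nhds
  · filter_upwards [self_mem_nhdsWithin] with y hy using sub_pos.2 (mem_Ioi.1 hy)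

theorem eventually_mul_lt {C δ : ℝ} (hδ : 0 < δ) : ∀ᶠ s : ℝ in 𝓝[>] 0, s * C < δ := by
  have : Tendsto (fun s : ℝ => s * C) (𝓝 0) (𝓝 0) := by
    simpa using (continuous_id.mul continuous_const).tendsto (0 : ℝ) (f := fun s : ℝ => s * C)
  exact nhdsWithin_le_nhds (this.eventually_lt_const hδ)

end NormalSolution

/-! ### Monotonicity of regular solutions -/

section Monotonicity

theorem lt_of_eventually_lt_right {ψ : ℝ → ℝ} {a b : ℝ} (hab : a < b)
    (hψ : ContinuousOn ψ (Icc a b)) (h : ∀ x ∈ Ico a b, ∀ᶠ y in 𝓝[>] x, ψ x < ψ y) :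
    ψ a < ψ b := by
  have key : ∀ a' ∈ Ico a b, ψ a' ≤ ψ b := by
    intro a' ha'
    have := image_le_of_liminf_slope_right_le_deriv_boundary (f := fun x => -ψ x) (a := a') (b := b)
      (B := fun _ => -ψ a') (B' := fun _ => 0) (hψ.neg.mono (Icc_subset_Icc_left ha'.1)) le_rfl
      continuousOn_const (fun x _ => hasDerivWithinAt_const _ _ _) (fun x hx r hr => ?_)
      (right_mem_Icc.2 ha'.2.le)
    · simpa using this
    · refine Eventually.frequently ?_
      filter_upwards [h x ⟨ha'.1.trans hx.1, hx.2⟩, self_mem_nhdsWithin] with y hy hxy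
      refine lt_of_le_of_lt ?_ hr
      rw [slope_def_field]
      exact div_nonpos_of_nonpos_of_nonneg (by linarith) (sub_nonneg.2 (le_of_lt hxy))
  obtain ⟨a', h1, h2⟩ := ((h a ⟨le_rfl, hab⟩).and (Ioo_mem_nhdsGT hab)).exists
  exact h1.trans_le (key a' ⟨h2.1.le, h2.2⟩)

variable {n : ℕ} {U V : Set (EuclideanSpace ℝ (Fin n))}
  {g : EuclideanSpace ℝ (Fin n) → EuclideanSpace ℝ (Fin n)} {u : EuclideanSpace ℝ (Fin n) → ℝ}

local notation "𝔼" => EuclideanSpace ℝ (Fin n)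

/-- A regular solution increases in every direction `d` with `⟪g x, d⟫ > 0`. Lifting the component
of `s • d` orthogonal to `g x` back from `x + s • d` ends on the ray spanned by `g x`, at a height
which is of first order in `s`, up to an error of second order. -/
theorem IsRegularSolution.eventually_lt (hu : IsRegularSolution U g V u) (hU : IsOpen U)
    (hg_ne : ∀ x ∈ U, g x ≠ 0) (hg : LocallyLipschitzOn U g) {x : 𝔼} (hx : x ∈ V) {d : 𝔼}
    (hd : 0 < inner ℝ (g x) d) : ∀ᶠ s : ℝ in 𝓝[>] 0, u x < u (x + s • d) := by
  have hxU := hu.subset hx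
  obtain ⟨f, e, K, M, r, m, hf, hge, hr, hm, hrU, hfg⟩ :=
    exists_isSlopeField hU hg hxU (hg_ne x hxU)
  have hN : 0 < ‖g x‖ := norm_pos_iff.2 (hg_ne x hxU)
  have he := hf.norm_eq_one
  have hM0 := hf.bound_nonneg
  set α : ℝ := inner ℝ e d with hα_def
  have hα : 0 < α := by
    rw [hge, inner_smul_left] at hd
    exact pos_of_mul_pos_right hd (by simp)
  set τ : 𝔼 := d - α • e with hτ_def
  have hτe : inner ℝ τ e = (0 : ℝ) := by
    rw [hτ_def, inner_sub_left, inner_smul_left, real_inner_self_eq_norm_sq, he, real_inner_comm]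
    simp [hα_def]
  have hτf : inner ℝ τ (f x) = (0 : ℝ) := by
    have hτg : inner ℝ τ (g x) = (0 : ℝ) := by rw [hge, inner_smul_right, hτe, mul_zero]
    rw [(hfg x (Metric.mem_ball_self hr)).2, inner_smul_right, hτg, mul_zero]
  obtain ⟨δ, hδ, hball⟩ := Metric.mem_nhds_iff.1
    (inter_mem (hu.isOpen.mem_nhds hx) (Metric.ball_mem_nhds x hr))
  obtain ⟨ε, hε, -, hmono⟩ := hu.increasing x hx
  set C : ℝ := ‖d‖ + ‖τ‖ + ‖τ‖ * M with hC_def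
  have hC0 : 0 ≤ C := by positivity
  have hs1 := eventually_mul_lt (C := C) hδ
  have hs2 := eventually_mul_lt (C := ‖τ‖ * K * C) hα
  have hs3 := eventually_mul_lt (C := 2 * α / ‖g x‖) hε
  filter_upwards [hs1, hs2, hs3, self_mem_nhdsWithin] with s h1 h2 h3 hs
  have hs : 0 < s := hs
  obtain ⟨w, hw0, hw⟩ := exists_isLift hf.lipschitz he hf.bound (x + s • d) (-(s • τ)) 0
  have hnear : ∀ t ∈ Icc (0 : ℝ) 1,
      ‖x + s • d + t • -(s • τ) + w t • e - x‖ ≤ s * C := by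
    intro t ht
    have e1 : x + s • d + t • -(s • τ) + w t • e - x = s • d - (t * s) • τ + w t • e := by module
    have hwt := hw.abs_sub_initial_le hf.bound ht
    rw [hw0, sub_zero, norm_neg, norm_smul, Real.norm_of_nonneg hs.le] at hwt
    rw [e1]
    have h5 : ‖s • d‖ = s * ‖d‖ := by rw [norm_smul, Real.norm_of_nonneg hs.le]
    have h6 : ‖(t * s) • τ‖ ≤ s * ‖τ‖ := by
      rw [norm_smul, Real.norm_of_nonneg (mul_nonneg ht.1 hs.le)]
      have := mul_le_of_le_one_left hs.le ht.2
      gcongr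
    have h7 : ‖w t • e‖ ≤ s * ‖τ‖ * M := by rwa [norm_smul, he, mul_one, Real.norm_eq_abs]
    calc _ ≤ ‖s • d‖ + ‖(t * s) • τ‖ + ‖w t • e‖ :=
          (norm_add_le _ _).trans (by gcongr; exact norm_sub_le _ _)
      _ ≤ s * ‖d‖ + s * ‖τ‖ + s * ‖τ‖ * M := by gcongr; exact h5.le
      _ = s * C := by rw [hC_def]; ring
  have hconst := hu.toIsNormalSolution.eq_along_lift hw (fun t ht => by
    have hmem := hball (mem_ball_iff_norm.2 ((hnear t ht).trans_lt h1))
    exact ⟨hmem.1, hm.trans_le (hfg _ hmem.2).1, (hfg _ hmem.2).2⟩)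
  have hw1 : |w 1| ≤ s * (s * (‖τ‖ * K * C)) := by
    have := norm_image_sub_le_of_norm_deriv_right_le_segment hw.continuousOn
      (fun t ht => hw.hasDerivWithinAt_Ici ht) (C := s * (s * (‖τ‖ * K * C)))
      (fun t ht => ?_) 1 (by simp)
    · simpa [hw0] using this
    · have ht' : t ∈ Icc (0 : ℝ) 1 := ⟨ht.1, ht.2.le⟩
      set q := x + s • d + t • -(s • τ) + w t • e
      have e1 : inner ℝ (-(s • τ)) (f q) = -(s * inner ℝ τ (f q - f x)) := by
        rw [inner_sub_right, hτf, inner_neg_left, inner_smul_left]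
        simp
      rw [e1, norm_neg, norm_mul, Real.norm_of_nonneg hs.le]
      gcongr
      calc ‖(inner ℝ τ (f q - f x) : ℝ)‖ ≤ ‖τ‖ * ‖f q - f x‖ := norm_inner_le_norm _ _
        _ ≤ ‖τ‖ * (K * (s * C)) := by
          gcongr
          refine (hf.lipschitz.norm_sub_le q x).trans ?_
          gcongr
          exact hnear t ht'
        _ = _ := by ring
  rw [hw0] at hconst
  have hend : x + s • d + -(s • τ) + w 1 • e = x + ((s * α + w 1) / ‖g x‖) • g x := by
    have hsmul : ((s * α + w 1) / ‖g x‖) • g x = (s * α + w 1) • e := by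
      conv_lhs => rw [div_eq_mul_inv, mul_smul, inv_smul_eq_iff₀ hN.ne' |>.2 hge]
    rw [hsmul, hτ_def]
    module
  rw [hend, zero_smul, add_zero] at hconst
  rw [← hconst]
  have hlo : 0 < s * α + w 1 := by
    have := abs_le.1 hw1
    nlinarith
  have hhi : s * α + w 1 < s * (2 * α) := by
    have := abs_le.1 hw1
    nlinarith
  have hpos : 0 < (s * α + w 1) / ‖g x‖ := by positivity
  have hlt : (s * α + w 1) / ‖g x‖ < ε := by
    refine lt_trans ?_ h3
    rw [← mul_div_assoc]
    gcongr
  have := hmono (a := 0) (b := (s * α + w 1) / ‖g x‖) ⟨by linarith, hε⟩ ⟨by linarith, hlt⟩ hpos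
  simpa using this

theorem IsNormalSolution.continuousOn (hu : IsNormalSolution U g V u) : ContinuousOn u V :=
  hu.locallyLipschitz.continuousOn

/-- A regular solution is strictly increasing along segments whose direction has positive inner
product with `g`. -/
theorem IsRegularSolution.lt_of_inner_pos (hu : IsRegularSolution U g V u) (hU : IsOpen U)
    (hg_ne : ∀ x ∈ U, g x ≠ 0) (hg : LocallyLipschitzOn U g) {x d : 𝔼} {b : ℝ} (hb : 0 < b)
    (h : ∀ t ∈ Icc (0 : ℝ) b, x + t • d ∈ V ∧ 0 < inner ℝ (g (x + t • d)) d) :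
    u x < u (x + b • d) := by
  have := lt_of_eventually_lt_right (ψ := fun t => u (x + t • d)) hb ?_ ?_
  · simpa using this
  · exact hu.toIsNormalSolution.continuousOn.comp (by fun_prop) (fun t ht => (h t ht).1)
  · intro t ht
    obtain ⟨h1, h2⟩ := h t ⟨ht.1, ht.2.le⟩
    have h3 := hu.eventually_lt hU hg_ne hg h1 h2
    filter_upwards [(tendsto_sub_nhdsGT t).eventually h3] with y hy
    convert hy using 2
    module

end Monotonicity

/-! ### Quasi-convexity and pseudomonotonicity -/

section QuasiConvexity

variable {n : ℕ} {U V : Set (EuclideanSpace ℝ (Fin n))}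
  {g : EuclideanSpace ℝ (Fin n) → EuclideanSpace ℝ (Fin n)} {u : EuclideanSpace ℝ (Fin n) → ℝ}

local notation "𝔼" => EuclideanSpace ℝ (Fin n)

/-- The slope of a lift has nonpositive lower right Dini derivative, if `g` satisfies the
infinitesimal condition. -/
theorem frequently_slope_lt {f : 𝔼 → 𝔼} {e : 𝔼} {K : ℝ≥0} {M m : ℝ} {B : Set 𝔼}
    (hii : ∀ x ∈ U, ∀ v : 𝔼, inner ℝ (g x) v = 0 →
      0 ≤ limsup (fun t : ℝ => ((1 / t * inner ℝ v (g (x + t • v)) : ℝ) : EReal)) (𝓝[>] 0))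
    (hf : IsSlopeField f e K M) (hm : 0 < m) (hB : IsOpen B) (hBU : B ⊆ U)
    (hfg : ∀ p ∈ B, m ≤ inner ℝ e (g p) ∧ f p = -(inner ℝ e (g p))⁻¹ • g p)
    {b h : 𝔼} {w : ℝ → ℝ} (hw : IsLift f e b h w) {t : ℝ} (ht : t ∈ Ico (0 : ℝ) 1)
    (hq : b + t • h + w t • e ∈ B) {r : ℝ} (hr : 0 < r) :
    ∃ᶠ z in 𝓝[>] t, slope (fun t => inner ℝ h (f (b + t • h + w t • e))) t z < r := by
  set q : ℝ → 𝔼 := fun t => b + t • h + w t • e with hq_def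
  set D : ℝ → ℝ := fun t => inner ℝ h (f (q t)) with hD_def
  set v : 𝔼 := h + D t • e with hv_def
  obtain ⟨hqm, hqf⟩ := hfg _ hq
  have hv0 : inner ℝ (g (q t)) v = 0 := inner_lift_eq_zero (hm.trans_le hqm).ne' hqf h
  have hfreq : ∃ᶠ s : ℝ in 𝓝[>] 0, -(r * m / 2) < 1 / s * inner ℝ v (g (q t + s • v)) := by
    have h1 := hii _ (hBU hq) v hv0
    have h2 : ((-(r * m / 2) : ℝ) : EReal) < 0 := by
      rw [EReal.coe_neg']
      have : 0 < r * m / 2 := by positivity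
      linarith
    exact (frequently_lt_of_lt_limsup (by isBoundedDefault) (h2.trans_le h1)).mono
      fun s hs => EReal.coe_lt_coe_iff.1 hs
  have hshift : Tendsto (fun s : ℝ => t + s) (𝓝[>] 0) (𝓝[>] t) := by
    refine tendsto_nhdsWithin_of_tendsto_nhds_of_eventually_within _ ?_ ?_
    · have : Tendsto (fun s : ℝ => t + s) (𝓝 0) (𝓝 (t + 0)) :=
        (continuous_const.add continuous_id).tendsto 0
      rw [add_zero] at this
      exact this.mono_left nhdsWithin_le_nhds
    · filter_upwards [self_mem_nhdsWithin] with s hs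
      simpa using hs
  refine hshift.frequently ?_
  have hin : ∀ᶠ s : ℝ in 𝓝[>] 0, q t + s • v ∈ B := by
    have : Tendsto (fun s : ℝ => q t + s • v) (𝓝 0) (𝓝 (q t + (0 : ℝ) • v)) :=
      (by fun_prop : Continuous fun s : ℝ => q t + s • v).tendsto 0
    rw [zero_smul, add_zero] at this
    exact nhdsWithin_le_nhds (this.eventually (hB.mem_nhds hq))
  -- replacing the tangent line by the lifted curve costs only `o(s)`, as `f` is Lipschitz
  have hlin : ∀ᶠ s : ℝ in 𝓝[>] 0, ‖q (t + s) - (q t + s • v)‖ * (‖v‖ * K) ≤ r / 2 * s := by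
    have hd : HasDerivWithinAt q v (Ioi t) t :=
      ((hw.hasDerivWithinAt_curve ⟨ht.1, ht.2.le⟩).mono_of_mem_nhdsWithin
        (mem_of_superset (Icc_mem_nhdsGE ht.2) (Icc_subset_Icc_left ht.1))).mono Ioi_subset_Ici_self
    have hc : 0 < r / 2 / (‖v‖ * K + 1) := by positivity
    filter_upwards [hshift.eventually (hd.isLittleO.def hc), self_mem_nhdsWithin] with s hs hs0
    have hs0 : 0 < s := hs0
    rw [add_sub_cancel_left, Real.norm_of_nonneg hs0.le, sub_sub] at hs
    calc _ ≤ r / 2 / (‖v‖ * K + 1) * s * (‖v‖ * K) := by gcongr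
      _ ≤ r / 2 / (‖v‖ * K + 1) * s * (‖v‖ * K + 1) := by gcongr; linarith
      _ = r / 2 * s := by field_simp
  refine (hfreq.and_eventually ((hin.and hlin).and self_mem_nhdsWithin)).mono ?_
  rintro s ⟨h1, ⟨h2, h3⟩, hs⟩
  have hs : 0 < s := hs
  obtain ⟨h4, h5⟩ := hfg _ h2
  set p := q t + s • v
  have hep : 0 < inner ℝ e (g p) := hm.trans_le h4
  have h6 : inner ℝ v (f p) < r / 2 * s := by
    have h7 : -(r * m / 2) * s < inner ℝ v (g p) := by
      rwa [one_div, inv_mul_eq_div, lt_div_iff₀ hs] at h1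
    rw [h5, inner_smul_right, neg_mul, neg_lt, inv_mul_eq_div, lt_div_iff₀ hep]
    refine lt_of_le_of_lt ?_ h7
    nlinarith [mul_pos hr hs]
  have h8 : inner ℝ v (f (q (t + s))) = D (t + s) - D t := by
    rw [hv_def, inner_add_left, inner_smul_left, hf.vertical]
    simp [hD_def]
    ring
  have h9 : inner ℝ v (f (q (t + s)) - f p) ≤ r / 2 * s := by
    refine (real_inner_le_norm _ _).trans (le_trans ?_ h3)
    have := hf.lipschitz.norm_sub_le (q (t + s)) p
    calc ‖v‖ * ‖f (q (t + s)) - f p‖ ≤ ‖v‖ * (K * ‖q (t + s) - p‖) := by gcongr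
      _ = _ := by ring
  rw [inner_sub_right, h8] at h9
  have h10 : slope D t (t + s) = (D (t + s) - D t) / s := by
    rw [slope_def_field, add_sub_cancel_left]
  rw [h10, div_lt_iff₀ hs]
  linarith

/-- If a regular solution is maximal on a segment at an interior point, then it is constant near
that point on the rest of the segment. The infinitesimal condition makes the curve in the level set
above the segment concave, so it lies on the side where the solution is larger. -/
theorem IsRegularSolution.exists_eq_of_max (hu : IsRegularSolution U g V u) (hU : IsOpen U)
    (hg_ne : ∀ x ∈ U, g x ≠ 0) (hg : LocallyLipschitzOn U g)
    (hii : ∀ x ∈ U, ∀ v : 𝔼, inner ℝ (g x) v = 0 →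
      0 ≤ limsup (fun t : ℝ => ((1 / t * inner ℝ v (g (x + t • v)) : ℝ) : EReal)) (𝓝[>] 0))
    {z v : 𝔼} (hz : z ∈ V) {ε : ℝ} (hε : 0 < ε)
    (hmax : ∀ t ∈ Ioo (-ε) ε, u (z + t • v) ≤ u z) :
    ∃ t ∈ Ioo 0 ε, u (z + t • v) = u z := by
  have hzU := hu.subset hz
  obtain ⟨f, e, K, M, r, m, hf, hge, hr, hm, hrU, hfg⟩ :=
    exists_isSlopeField hU hg hzU (hg_ne z hzU)
  have he := hf.norm_eq_one
  have hM0 := hf.bound_nonneg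
  have hgv : 0 ≤ inner ℝ (g z) v := by
    by_contra! hneg
    have h1 := hu.eventually_lt hU hg_ne hg hz (d := -v) (by rw [inner_neg_right]; linarith)
    obtain ⟨s, h2, h3⟩ := (h1.and (Ioo_mem_nhdsGT hε)).exists
    have h4 := hmax (-s) ⟨by linarith [h3.2], by linarith [h3.1]⟩
    rw [neg_smul, ← smul_neg] at h4
    linarith
  obtain ⟨δ, hδ, hball⟩ := Metric.mem_nhds_iff.1
    (inter_mem (hu.isOpen.mem_nhds hz) (Metric.ball_mem_nhds z hr))
  obtain ⟨η, hη1, hη2⟩ := ((eventually_mul_lt (C := ‖v‖ + ‖v‖ * M) hδ).and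
    (Ioo_mem_nhdsGT hε)).exists
  have hη := hη2.1
  refine ⟨η, hη2, ?_⟩
  obtain ⟨w, hw0, hw⟩ := exists_isLift hf.lipschitz he hf.bound z (η • v) 0
  have hmem : ∀ t ∈ Icc (0 : ℝ) 1, z + t • η • v + w t • e ∈ Metric.ball z δ := by
    intro t ht
    have hwt := hw.abs_sub_initial_le hf.bound ht
    rw [hw0, sub_zero, norm_smul, Real.norm_of_nonneg hη.le] at hwt
    rw [mem_ball_iff_norm, add_assoc, add_sub_cancel_left]
    refine lt_of_le_of_lt ((norm_add_le _ _).trans ?_) hη1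
    rw [norm_smul, norm_smul, norm_smul, he, mul_one, Real.norm_of_nonneg hη.le,
      Real.norm_of_nonneg ht.1, Real.norm_eq_abs]
    have := mul_le_of_le_one_left (mul_nonneg hη.le (norm_nonneg v)) ht.2
    linarith
  have hconst := hu.toIsNormalSolution.eq_along_lift hw (fun t ht => by
    have := hball (hmem t ht)
    exact ⟨this.1, hm.trans_le (hfg _ this.2).1, (hfg _ this.2).2⟩)
  rw [hw0, zero_smul, add_zero] at hconst
  set D : ℝ → ℝ := fun t => inner ℝ (η • v) (f (z + t • η • v + w t • e)) with hD_def
  have hDcont : ContinuousOn D (Icc 0 1) := by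
    have h1 : ContinuousOn (fun t => z + t • η • v + w t • e) (Icc 0 1) := fun t ht =>
      (hw.hasDerivWithinAt_curve ht).continuousWithinAt
    exact continuousOn_const.inner (hf.lipschitz.continuous.comp_continuousOn h1)
  have hD0 : D 0 ≤ 0 := by
    obtain ⟨h1, h2⟩ := hfg z (Metric.mem_ball_self hr)
    simp only [hD_def, hw0, zero_smul, add_zero]
    rw [h2, inner_smul_left, inner_smul_right, real_inner_comm (g z) v]
    have : 0 ≤ η * ((inner ℝ e (g z))⁻¹ * inner ℝ (g z) v) :=
      mul_nonneg hη.le (mul_nonneg (inv_nonneg.2 (hm.le.trans h1)) hgv)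
    simp only [RCLike.conj_to_real]
    linarith
  have hD : ∀ ⦃t⦄, t ∈ Icc (0 : ℝ) 1 → D t ≤ 0 :=
    image_le_of_liminf_slope_right_le_deriv_boundary hDcont (B := fun _ => 0) (B' := fun _ => 0)
      hD0 continuousOn_const (fun _ _ => hasDerivWithinAt_const _ _ _) (fun t ht r' hr' =>
        frequently_slope_lt hii hf hm Metric.isOpen_ball hrU hfg hw ht
          (hball (hmem t ⟨ht.1, ht.2.le⟩)).2 hr')
  have hw1 : w 1 ≤ 0 :=
    image_le_of_deriv_right_le_deriv_boundary hw.continuousOn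
      (fun t ht => hw.hasDerivWithinAt_Ici ht) (B := fun _ => 0) (B' := fun _ => 0)
      hw0.le continuousOn_const (fun _ _ => hasDerivWithinAt_const _ _ _)
      (fun t ht => hD ⟨ht.1, ht.2.le⟩) (right_mem_Icc.2 zero_le_one)
  rcases hw1.eq_or_lt with h0 | hneg
  · rwa [h0, zero_smul, add_zero] at hconst
  · exfalso
    have h1 := hmax η ⟨by linarith, hη2.2⟩
    have hend := hmem 1 (by simp)
    rw [one_smul] at hend
    have h2 : z + η • v ∈ Metric.ball z δ := by
      rw [mem_ball_iff_norm, add_sub_cancel_left, norm_smul, Real.norm_of_nonneg hη.le]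
      refine lt_of_le_of_lt ?_ hη1
      have := mul_nonneg hη.le (mul_nonneg (norm_nonneg v) hM0)
      linarith
    have h3 := hu.lt_of_inner_pos hU hg_ne hg (x := z + η • v + w 1 • e) (d := e) (b := -w 1)
      (by linarith) (fun t ht => by
        have h4 : z + η • v + w 1 • e + t • e ∈ Metric.ball z δ := by
          have := (convex_ball z δ).add_smul_sub_mem hend h2 (t := t / (-w 1))
            ⟨div_nonneg ht.1 (by linarith), (div_le_one (by linarith)).2 ht.2⟩
          convert this using 1
          have h5 : t • e = (t / -w 1) • ((-w 1) • e) := by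
            rw [smul_smul, div_mul_cancel₀]
            exact (neg_pos.2 hneg).ne'
          rw [h5]
          module
        have h6 := hball h4
        refine ⟨h6.1, ?_⟩
        rw [real_inner_comm]
        exact hm.trans_le (hfg _ h6.2).1)
    have h7 : z + η • v + w 1 • e + -w 1 • e = z + η • v := by module
    rw [h7] at h3
    linarith

theorem IsRegularSolution.quasiconvexOn (hu : IsRegularSolution U g V u) (hU : IsOpen U)
    (hg_ne : ∀ x ∈ U, g x ≠ 0) (hg : LocallyLipschitzOn U g)
    (hii : ∀ x ∈ U, ∀ v : 𝔼, inner ℝ (g x) v = 0 →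
      0 ≤ limsup (fun t : ℝ => ((1 / t * inner ℝ v (g (x + t • v)) : ℝ) : EReal)) (𝓝[>] 0))
    (hV : Convex ℝ V) : QuasiconvexOn ℝ V u := by
  intro r
  rw [convex_iff_segment_subset]
  rintro x ⟨hx, hxr⟩ y ⟨hy, hyr⟩ p hp
  have hpV : p ∈ V := hV.segment_subset hx hy hp
  refine ⟨hpV, ?_⟩
  by_contra! hpr
  rw [segment_eq_image'] at hp
  obtain ⟨t₀, ht₀, rfl⟩ := hp
  simp only at hpr hpV
  set φ : ℝ → ℝ := fun t => u (x + t • (y - x)) with hφ_def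
  have hseg : ∀ t ∈ Icc (0 : ℝ) 1, x + t • (y - x) ∈ V := fun t ht =>
    hV.add_smul_sub_mem hx hy ht
  have hφ : ContinuousOn φ (Icc 0 1) :=
    hu.toIsNormalSolution.continuousOn.comp (by fun_prop) hseg
  obtain ⟨t₁, ht₁, hmax⟩ := isCompact_Icc.exists_isMaxOn ⟨t₀, ht₀⟩ hφ
  have hrc : r < φ t₁ := lt_of_lt_of_le hpr (hmax ht₀)
  -- the maximum is attained at a last point `t₂`
  have hScompact : IsCompact (Icc (0 : ℝ) 1 ∩ φ ⁻¹' {φ t₁}) :=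
    isCompact_Icc.of_isClosed_subset (hφ.preimage_isClosed_of_isClosed isClosed_Icc
      isClosed_singleton) inter_subset_left
  obtain ⟨t₂, ⟨ht₂, ht₂'⟩, hgreatest⟩ := hScompact.exists_isGreatest ⟨t₁, ht₁, rfl⟩
  have ht₂' : φ t₂ = φ t₁ := ht₂'
  have h0 : 0 < t₂ := by
    rcases ht₂.1.eq_or_lt with h | h
    · rw [← h] at ht₂'
      simp only [hφ_def, zero_smul, add_zero] at ht₂' hrc
      linarith
    · exact h
  have h1 : t₂ < 1 := by
    rcases ht₂.2.eq_or_lt with h | h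
    · rw [h] at ht₂'
      simp only [hφ_def, one_smul, add_sub_cancel] at ht₂' hrc
      linarith
    · exact h
  have hshift : ∀ t : ℝ, x + t₂ • (y - x) + t • (y - x) = x + (t₂ + t) • (y - x) := fun t => by
    module
  obtain ⟨t, ht, heq⟩ := hu.exists_eq_of_max hU hg_ne hg hii (hseg t₂ ht₂) (v := y - x)
    (lt_min h0 (sub_pos.2 h1)) (fun t ht => by
      rw [hshift]
      refine (hmax (a := t₂ + t) ⟨?_, ?_⟩).trans_eq ht₂'.symm
      · linarith [ht.1, min_le_left t₂ (1 - t₂)]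
      · linarith [ht.2, min_le_right t₂ (1 - t₂)])
  rw [hshift] at heq
  have := hgreatest (a := t₂ + t) ⟨⟨by linarith [ht.1], by
    linarith [ht.2, min_le_right t₂ (1 - t₂)]⟩, heq.trans ht₂'⟩
  linarith [ht.1]

theorem limsup_nonneg_of_local_pseudomonotone
    (hi : ∀ xs ∈ U, ∃ V : Set 𝔼, IsOpen V ∧ xs ∈ V ∧ V ⊆ U ∧
        ∀ x ∈ V, ∀ y ∈ V, inner ℝ (g x) y ≥ inner ℝ (g x) x →
          inner ℝ (g y) x ≤ inner ℝ (g y) y) {x : 𝔼} (hx : x ∈ U) {v : 𝔼}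
    (hv : inner ℝ (g x) v = 0) :
    0 ≤ limsup (fun t : ℝ => ((1 / t * inner ℝ v (g (x + t • v)) : ℝ) : EReal)) (𝓝[>] 0) := by
  obtain ⟨V, hV, hxV, -, hmono⟩ := hi x hx
  have hin : ∀ᶠ s : ℝ in 𝓝[>] 0, x + s • v ∈ V := by
    have : Tendsto (fun s : ℝ => x + s • v) (𝓝 0) (𝓝 (x + (0 : ℝ) • v)) :=
      (by fun_prop : Continuous fun s : ℝ => x + s • v).tendsto 0
    rw [zero_smul, add_zero] at this
    exact nhdsWithin_le_nhds (this.eventually (hV.mem_nhds hxV))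
  have hev : ∀ᶠ s : ℝ in 𝓝[>] 0,
      (0 : EReal) ≤ ((1 / s * inner ℝ v (g (x + s • v)) : ℝ) : EReal) := by
    filter_upwards [hin, self_mem_nhdsWithin] with s hs hs0
    have hs0 : 0 < s := hs0
    have h1 := hmono x hxV _ hs (by rw [inner_add_right, inner_smul_right, hv]; simp)
    rw [inner_add_right, inner_smul_right, real_inner_comm v] at h1
    have h2 : 0 ≤ inner ℝ v (g (x + s • v)) := nonneg_of_mul_nonneg_right (by linarith) hs0
    exact_mod_cast mul_nonneg (by positivity) h2
  exact le_limsup_of_frequently_le hev.frequently (by isBoundedDefault)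

/-- Quasi-convexity of a regular solution makes its field of normals pseudomonotone. -/
theorem IsRegularSolution.inner_le_of_quasiconvexOn (hu : IsRegularSolution U g V u)
    (hU : IsOpen U) (hg_ne : ∀ x ∈ U, g x ≠ 0) (hg : LocallyLipschitzOn U g)
    (hq : QuasiconvexOn ℝ V u) {x y : 𝔼} (hx : x ∈ V) (hy : y ∈ V)
    (hxy : inner ℝ (g x) y ≥ inner ℝ (g x) x) : inner ℝ (g y) x ≤ inner ℝ (g y) y := by
  have key : ∀ p ∈ V, ∀ q ∈ V, 0 < inner ℝ (g p) (q - p) → u p < u q := by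
    intro p hp q hq' hpq
    obtain ⟨s, h1, h2⟩ := ((hu.eventually_lt hU hg_ne hg hp hpq).and
      (Ioo_mem_nhdsGT (zero_lt_one' ℝ))).exists
    by_contra! hle
    have h3 := (hq (u p)).add_smul_sub_mem (x := p) (y := q) ⟨hp, le_rfl⟩ ⟨hq', hle⟩
      ⟨h2.1.le, h2.2.le⟩
    exact absurd h3.2 (not_le.2 h1)
  by_contra! hlt
  -- pushing `y` along `g x` makes the first inequality strict and preserves the second
  have hxU := hu.subset hx
  have hyU := hu.subset hy
  have hpos : 0 < inner ℝ (g x) (g x) := real_inner_self_pos.2 (hg_ne x hxU)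
  have hcont : ContinuousAt (fun s : ℝ => y + s • g x) 0 := by fun_prop
  have hgc : ContinuousAt (fun s : ℝ => g (y + s • g x)) 0 := by
    have : ContinuousAt g (y + (0 : ℝ) • g x) := by
      simpa using hg.continuousOn.continuousAt (hU.mem_nhds hyU)
    exact ContinuousAt.comp (f := fun s : ℝ => y + s • g x) this hcont
  have h1 : ∀ᶠ s : ℝ in 𝓝 0, 0 < inner ℝ (g (y + s • g x)) (x - (y + s • g x)) := by
    have : ContinuousAt (fun s : ℝ => (inner ℝ (g (y + s • g x)) (x - (y + s • g x)) : ℝ)) 0 :=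
      hgc.inner (continuousAt_const.sub hcont)
    refine this.eventually_const_lt ?_
    simp only [zero_smul, add_zero, inner_sub_right]
    linarith
  have h2 : ∀ᶠ s : ℝ in 𝓝 0, y + s • g x ∈ V :=
    hcont.eventually (hu.isOpen.mem_nhds (by simpa using hy))
  obtain ⟨s, ⟨h1, h2⟩, hs⟩ := (((h1.and h2).filter_mono nhdsWithin_le_nhds).and
    (self_mem_nhdsWithin (a := (0 : ℝ)) (s := Ioi 0))).exists
  have hs : 0 < s := hs
  have h3 := key _ h2 x hx h1
  have h4 := key x hx _ h2 (by
    rw [inner_sub_right, inner_add_right, inner_smul_right]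
    nlinarith [mul_pos hs hpos])
  linarith

end QuasiConvexity

/-! ### Mollification of slope fields -/

section Mollification

variable {E : Type*} [NormedAddCommGroup E] [InnerProductSpace ℝ E]

/-- The curvature of the plane field orthogonal to `f`, at a point where `f` has the value `y` and
the derivative `A`: the antisymmetrized derivative of `⟪k, f⟫` along the lift of `h`. It vanishes
exactly when the plane field is integrable. -/
noncomputable def curvature (e : E) (A : E →L[ℝ] E) (y h k : E) : ℝ :=
  inner ℝ k (A (h + (inner ℝ h y : ℝ) • e)) - inner ℝ h (A (k + (inner ℝ k y : ℝ) • e))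

theorem abs_curvature_sub_le (e : E) (he : ‖e‖ = 1) (A : E →L[ℝ] E) (y y' h k : E) :
    |curvature e A y h k - curvature e A y' h k| ≤ 2 * ‖A‖ * ‖y - y'‖ * ‖h‖ * ‖k‖ := by
  have e1 : curvature e A y h k - curvature e A y' h k
      = inner ℝ h (y - y') * inner ℝ k (A e) - inner ℝ k (y - y') * inner ℝ h (A e) := by
    simp only [curvature, map_add, map_smul, inner_add_right, inner_smul_right, inner_sub_right]
    ring
  have hAe : ‖A e‖ ≤ ‖A‖ := by simpa [he] using A.le_opNorm e
  have hb : ∀ a b : E, |inner ℝ a (y - y') * inner ℝ b (A e)| ≤ ‖a‖ * ‖y - y'‖ * (‖b‖ * ‖A‖) :=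
    fun a b => by
      rw [abs_mul]
      gcongr
      · exact abs_real_inner_le_norm _ _
      · exact (abs_real_inner_le_norm _ _).trans (by gcongr)
  rw [e1]
  refine (abs_sub _ _).trans ?_
  linarith [hb h k, hb k h]

theorem norm_integral_smul_le {α G : Type*} [MeasurableSpace α] {μ : Measure α}
    [NormedAddCommGroup G] [NormedSpace ℝ G] {φ : α → ℝ} (hφ : ∀ a, 0 ≤ φ a)
    (hφi : Integrable φ μ) (hφ1 : ∫ a, φ a ∂μ = 1) {H : α → G} {C : ℝ}
    (hH : ∀ᵐ a ∂μ, φ a ≠ 0 → ‖H a‖ ≤ C) : ‖∫ a, φ a • H a ∂μ‖ ≤ C := by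
  have := norm_integral_le_of_norm_le (f := fun a => φ a • H a) (hφi.mul_const C) (by
    filter_upwards [hH] with a ha
    rw [norm_smul, Real.norm_of_nonneg (hφ a)]
    rcases eq_or_ne (φ a) 0 with h | h
    · simp [h]
    · exact mul_le_mul_of_nonneg_left (ha h) (hφ a))
  rwa [integral_mul_const, hφ1, one_mul] at this

variable [FiniteDimensional ℝ E] [MeasurableSpace E] [BorelSpace E] {μ : Measure E} [μ.IsAddHaarMeasure]

/-- A slope field whose curvature vanishes almost everywhere on a ball is approximated by smooth
slope fields with the same bounds and with uniformly small curvature. The curvature is quadratic in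
the field, but its quadratic part is the product of the field, which mollification changes
uniformly little, and of its derivative, which is bounded. -/
theorem IsSlopeField.exists_smooth_approx {f : E → E} {e : E} {K : ℝ≥0} {M : ℝ}
    (hf : IsSlopeField f e K M) {b : E} {R : ℝ}
    (hcurv : ∀ᵐ p ∂μ, p ∈ Metric.ball b R → ∀ h k, curvature e (fderiv ℝ f p) (f p) h k = 0)
    {ε : ℝ} (hε : 0 < ε) :
    ∃ F : E → E, IsSlopeField F e K M ∧ ContDiff ℝ 1 F ∧ (∀ p, ‖F p - f p‖ ≤ K * ε) ∧
      ∀ p ∈ Metric.ball b (R - ε), ∀ h k,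
        |curvature e (fderiv ℝ F p) (F p) h k| ≤ 4 * K ^ 2 * ε * ‖h‖ * ‖k‖ := by
  let Φ : ContDiffBump (0 : E) := ⟨ε / 2, ε, by positivity, by linarith⟩
  set φ : E → ℝ := Φ.normed μ with hφ_def
  have hφ0 : ∀ a, 0 ≤ φ a := Φ.nonneg_normed
  have hφi : Integrable φ μ := Φ.integrable_normed
  have hφ1 : ∫ a, φ a ∂μ = 1 := Φ.integral_normed
  have hφc : Continuous φ := (Φ.contDiff_normed (n := 0)).continuous
  have hφs : ∀ a, φ a ≠ 0 → ‖a‖ < ε := fun a ha => by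
    have : a ∈ Function.support (Φ.normed μ) := ha
    rw [Φ.support_normed_eq] at this
    simpa using this
  have hfc := hf.lipschitz.continuous
  have hint : ∀ p, Integrable (fun a => φ a • f (p - a)) μ := fun p =>
    (hφi.mul_const M).mono' (by fun_prop) (.of_forall fun a => by
      rw [norm_smul, Real.norm_of_nonneg (hφ0 a)]
      exact mul_le_mul_of_nonneg_left (hf.bound _) (hφ0 a))
  set F : E → E := fun p => ∫ a, φ a • f (p - a) ∂μ with hF_def
  have hFf : ∀ p, ‖F p - f p‖ ≤ K * ε := by
    intro p
    have h1 : F p - f p = ∫ a, φ a • (f (p - a) - f p) ∂μ := by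
      simp only [smul_sub]
      rw [integral_sub (hint p) (hφi.smul_const _), integral_smul_const, hφ1, one_smul]
    rw [h1]
    refine norm_integral_smul_le hφ0 hφi hφ1 (.of_forall fun a ha => ?_)
    refine (hf.lipschitz.norm_sub_le _ _).trans ?_
    gcongr
    simpa using (hφs a ha).le
  have hdiff : ∀ p, ∀ᵐ a ∂μ, DifferentiableAt ℝ f (p - a) := fun p =>
    (quasiMeasurePreserving_sub_left μ p).ae hf.lipschitz.ae_differentiableAt
  have hderiv : ∀ p, Integrable (fun a => φ a • fderiv ℝ f (p - a)) μ ∧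
      HasFDerivAt F (∫ a, φ a • fderiv ℝ f (p - a) ∂μ) p := by
    intro p
    refine hasFDerivAt_integral_of_dominated_loc_of_lip (F := fun p a => φ a • f (p - a))
      (bound := fun a => φ a * K) univ_mem (.of_forall fun q => (hint q).aestronglyMeasurable)
      (hint p) ?_ (.of_forall fun a => ?_) (hφi.mul_const _) ?_
    · exact hφc.aestronglyMeasurable.smul
        ((measurable_fderiv ℝ f).comp (measurable_const.sub measurable_id)).aestronglyMeasurable
    · refine LipschitzOnWith.of_dist_le_mul fun x _ y _ => ?_
      rw [Real.coe_nnabs, abs_of_nonneg (mul_nonneg (hφ0 a) K.coe_nonneg), dist_eq_norm, ← smul_sub,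
        norm_smul, Real.norm_of_nonneg (hφ0 a), mul_assoc]
      refine mul_le_mul_of_nonneg_left ?_ (hφ0 a)
      have := hf.lipschitz.norm_sub_le (x - a) (y - a)
      rwa [sub_sub_sub_cancel_right, ← dist_eq_norm x y] at this
    · filter_upwards [hdiff p] with a ha
      exact (ha.hasFDerivAt.comp p ((hasFDerivAt_id p).sub_const a)).const_smul (φ a)
  refine ⟨F, ⟨?_, ?_, ?_, hf.norm_eq_one⟩, ?_, hFf, ?_⟩
  · refine LipschitzWith.of_dist_le_mul fun p q => ?_
    have h1 : F p - F q = ∫ a, φ a • (f (p - a) - f (q - a)) ∂μ := by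
      simp only [smul_sub]
      rw [integral_sub (hint p) (hint q)]
    rw [dist_eq_norm, h1]
    refine norm_integral_smul_le hφ0 hφi hφ1 (.of_forall fun a _ => ?_)
    have := hf.lipschitz.norm_sub_le (p - a) (q - a)
    rwa [sub_sub_sub_cancel_right, ← dist_eq_norm p q] at this
  · exact fun p => norm_integral_smul_le hφ0 hφi hφ1 (.of_forall fun a _ => hf.bound _)
  · intro p
    have h1 := (innerSL ℝ e).integral_comp_comm (hint p)
    simp only [innerSL_apply_apply, inner_smul_right, hf.vertical] at h1
    rw [hF_def, ← h1, integral_mul_const, hφ1, one_mul]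
  · exact Φ.hasCompactSupport_normed.contDiff_convolution_left (ContinuousLinearMap.lsmul ℝ ℝ)
      (n := 1) Φ.contDiff_normed hfc.locallyIntegrable
  · intro p hp h k
    obtain ⟨hi, hd⟩ := hderiv p
    set y := F p
    set L : (E →L[ℝ] E) →L[ℝ] ℝ :=
      (innerSL ℝ k).comp (ContinuousLinearMap.apply ℝ E (h + (inner ℝ h y : ℝ) • e)) -
        (innerSL ℝ h).comp (ContinuousLinearMap.apply ℝ E (k + (inner ℝ k y : ℝ) • e)) with hL_def
    have hL : ∀ A, L A = curvature e A y h k := fun A => by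
      simp [hL_def, curvature, inner_add_right, inner_smul_right]
    have h1 := L.integral_comp_comm hi
    rw [hd.fderiv, ← hL, ← h1, ← Real.norm_eq_abs]
    simp only [map_smul]
    refine norm_integral_smul_le hφ0 hφi hφ1 ?_
    filter_upwards [(quasiMeasurePreserving_sub_left μ p).ae hcurv] with a ha hφa
    have hea := hφs a hφa
    have hmem : p - a ∈ Metric.ball b R := by
      rw [mem_ball_iff_norm] at hp ⊢
      calc ‖p - a - b‖ = ‖(p - b) - a‖ := by congr 1; abel
        _ ≤ ‖p - b‖ + ‖a‖ := norm_sub_le _ _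
        _ < R := by linarith
    have h2 := abs_curvature_sub_le e hf.norm_eq_one (fderiv ℝ f (p - a)) y (f (p - a)) h k
    rw [ha hmem h k, sub_zero, ← hL] at h2
    refine h2.trans ?_
    have h3 : ‖y - f (p - a)‖ ≤ 2 * (K * ε) := by
      have h4 : ‖f p - f (p - a)‖ ≤ K * ε := by
        refine (hf.lipschitz.norm_sub_le _ _).trans ?_
        rw [sub_sub_cancel]
        gcongr
      have := norm_sub_le_norm_sub_add_norm_sub y (f p) (f (p - a))
      linarith [hFf p]
    have h5 := norm_fderiv_le_of_lipschitz ℝ (x₀ := p - a) hf.lipschitz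
    calc _ ≤ 2 * (K : ℝ) * (2 * (K * ε)) * ‖h‖ * ‖k‖ := by gcongr
      _ = _ := by ring

end Mollification

/-! ### The theorem of Frobenius for Lipschitz slope fields -/

section Frobenius

variable {E : Type*} [NormedAddCommGroup E] [InnerProductSpace ℝ E]

theorem exists_uniform_taylor {F : E → E} (hF : ContDiff ℝ 1 F) {S : Set E} (hS : IsCompact S)
    {η : ℝ} (hη : 0 < η) : ∃ δ > 0, ∀ p ∈ S, ∀ q, ‖q - p‖ < δ →
      ‖F q - F p - fderiv ℝ F p (q - p)‖ ≤ η * ‖q - p‖ := by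
  have hc : Continuous (fderiv ℝ F) := hF.continuous_fderiv one_ne_zero
  obtain ⟨δ, hδ, h⟩ := Metric.mem_uniformity_dist.1
    (hS.uniformContinuousAt_of_continuousAt (fderiv ℝ F) (fun a _ => hc.continuousAt)
      (Metric.dist_mem_uniformity hη))
  refine ⟨δ, hδ, fun p hp q hq => ?_⟩
  refine (convex_ball p δ).norm_image_sub_le_of_norm_hasFDerivWithin_le' (f := F)
    (fun x _ => ((hF.differentiable one_ne_zero) x).hasFDerivAt.hasFDerivWithinAt)
    (fun x hx => ?_) (Metric.mem_ball_self hδ) (mem_ball_iff_norm.2 hq)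
  have h1 : dist (fderiv ℝ F p) (fderiv ℝ F x) < η := h (by rwa [dist_comm]) hp
  rw [dist_comm, dist_eq_norm] at h1
  exact h1.le

/-- For a smooth slope field, the end point of the lift of `h` moves, when `h` is moved in the
direction `k`, with the slope prescribed by the field at that point, up to an error controlled by
the curvature along the lift: the deviation from that slope satisfies a linear differential
equation whose inhomogeneity is the curvature. -/
theorem IsSlopeField.eventually_transport_sub_le {F : E → E} {e : E} {K : ℝ≥0} {M : ℝ}
    (hF : IsSlopeField F e K M) (hF1 : ContDiff ℝ 1 F) {b h k : E} {c κ r : ℝ}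
    (hκ : ∀ w, w 0 = c → IsLift F e b h w → ∀ t ∈ Icc (0 : ℝ) 1,
      |curvature e (fderiv ℝ F (b + t • h + w t • e)) (F (b + t • h + w t • e)) h k| ≤ κ)
    (hr : κ * Real.exp (‖h‖ * K) < r) :
    ∀ᶠ δ : ℝ in 𝓝[>] 0, |transport F e b (h + δ • k) c - transport F e b h c
      - δ * inner ℝ k (F (b + h + transport F e b h c • e))| ≤ r * δ := by
  have he := hF.norm_eq_one
  have hM0 := hF.bound_nonneg
  obtain ⟨w, hw0, hw1, hw⟩ := hF.exists_lift b h c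
  set P : ℝ → E := fun t => b + t • h + w t • e with hP_def
  have hPd : ∀ t ∈ Icc (0 : ℝ) 1, HasDerivWithinAt P (h + (inner ℝ h (F (P t)) : ℝ) • e)
      (Icc 0 1) t := fun t ht => hw.hasDerivWithinAt_curve ht
  have hPc : ContinuousOn P (Icc 0 1) := fun t ht => (hPd t ht).continuousWithinAt
  set X : ℝ := Real.exp (‖h‖ * K) with hX_def
  have hX : 0 < X := Real.exp_pos _
  set C : ℝ := ‖k‖ + (‖k‖ * M + ‖h‖ * (K * ‖k‖)) * X with hC_def
  have hC0 : 0 ≤ C := by positivity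
  have hκ0 : 0 ≤ κ := (abs_nonneg _).trans (hκ w hw0 hw 0 (by simp))
  obtain ⟨η, hη, hηr⟩ : ∃ η > 0, κ * X + ‖h‖ * η * C * X < r := by
    have h1 : Tendsto (fun η : ℝ => κ * X + ‖h‖ * η * C * X) (𝓝[>] 0)
        (𝓝 (κ * X + ‖h‖ * 0 * C * X)) :=
      ((by fun_prop : Continuous fun η : ℝ => κ * X + ‖h‖ * η * C * X).tendsto 0).mono_left
        nhdsWithin_le_nhds
    obtain ⟨η, h2, h3⟩ := ((h1.eventually_lt_const (by simpa using hr)).and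
      self_mem_nhdsWithin).exists
    exact ⟨η, h3, h2⟩
  obtain ⟨δ₁, hδ₁, htaylor⟩ := exists_uniform_taylor hF1 (isCompact_Icc.image_of_continuousOn hPc) hη
  filter_upwards [eventually_mul_lt (C := C) hδ₁,
    eventually_mul_lt (C := ‖k‖ * K * C * X) (sub_pos.2 hηr), self_mem_nhdsWithin] with δ h1 h2 hδ
  have hδ : 0 < δ := hδ
  obtain ⟨v, hv0, hv1, hv⟩ := hF.exists_lift b (h + δ • k) c
  set Q : ℝ → E := fun t => b + t • (h + δ • k) + v t • e with hQ_def
  set D : ℝ → ℝ := fun t => v t - w t - δ * t * inner ℝ k (F (P t)) with hD_def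
  have hnormk : ‖δ • k‖ = δ * ‖k‖ := by rw [norm_smul, Real.norm_of_nonneg hδ.le]
  have hQP : ∀ t ∈ Icc (0 : ℝ) 1, ‖Q t - P t‖ ≤ δ * C := by
    intro t ht
    have h3 := hw.abs_sub_le (ε := 0) hF.lipschitz he hF.bound (by simp) hv ht
    rw [hw0, hv0, sub_self, abs_zero, add_sub_cancel_left, sub_self, norm_zero, zero_add, zero_add,
      zero_add, hnormk, abs_sub_comm] at h3
    have e1 : Q t - P t = (t * δ) • k + (v t - w t) • e := by simp only [hQ_def, hP_def]; module
    rw [e1]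
    refine (norm_add_le _ _).trans ?_
    rw [norm_smul, norm_smul, he, mul_one, Real.norm_of_nonneg (mul_nonneg ht.1 hδ.le),
      Real.norm_eq_abs]
    have h4 := mul_le_mul_of_nonneg_right (mul_le_of_le_one_left hδ.le ht.2) (norm_nonneg k)
    calc _ ≤ δ * ‖k‖ + (δ * ‖k‖ * M + ‖h‖ * (K * (δ * ‖k‖))) * X := add_le_add h4 h3
      _ = δ * C := by rw [hC_def]; ring
  have hDd : ∀ t ∈ Icc (0 : ℝ) 1, HasDerivWithinAt D (inner ℝ (h + δ • k) (F (Q t))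
      - inner ℝ h (F (P t)) - (δ * inner ℝ k (F (P t)) + δ * t *
        inner ℝ k (fderiv ℝ F (P t) (h + (inner ℝ h (F (P t)) : ℝ) • e)))) (Icc 0 1) t := by
    intro t ht
    have h3 : HasDerivWithinAt (fun t => (inner ℝ k (F (P t)) : ℝ))
        (inner ℝ k (fderiv ℝ F (P t) (h + (inner ℝ h (F (P t)) : ℝ) • e))) (Icc 0 1) t :=
      (innerSL ℝ k).hasFDerivAt.comp_hasDerivWithinAt t
        (((hF1.differentiable one_ne_zero) (P t)).hasFDerivAt.comp_hasDerivWithinAt t (hPd t ht))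
    have h4 : HasDerivWithinAt (fun t : ℝ => δ * t) δ (Icc 0 1) t := by
      simpa using (hasDerivWithinAt_id t (Icc (0 : ℝ) 1)).const_mul δ
    exact ((hv t ht).fun_sub (hw t ht)).fun_sub (h4.fun_mul h3)
  -- `D` starts at `0` and satisfies a linear differential inequality with the curvature as source
  have hbound : ∀ t ∈ Icc (0 : ℝ) 1, ‖inner ℝ (h + δ • k) (F (Q t))
      - inner ℝ h (F (P t)) - (δ * inner ℝ k (F (P t)) + δ * t *
        inner ℝ k (fderiv ℝ F (P t) (h + (inner ℝ h (F (P t)) : ℝ) • e)))‖ ≤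
      ‖h‖ * K * ‖D t‖ + δ * (κ + ‖h‖ * η * C + δ * (‖k‖ * K * C)) := by
    intro t ht
    set A := fderiv ℝ F (P t) with hA_def
    have hA : ‖A‖ ≤ K := norm_fderiv_le_of_lipschitz ℝ hF.lipschitz
    have e1 : Q t - P t = (δ * t) • (k + (inner ℝ k (F (P t)) : ℝ) • e) + D t • e := by
      simp only [hQ_def, hP_def, hD_def]
      module
    have e2 : inner ℝ h (A (Q t - P t)) = δ * t *
        inner ℝ h (A (k + (inner ℝ k (F (P t)) : ℝ) • e)) + D t * inner ℝ h (A e) := by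
      rw [e1, map_add, map_smul, map_smul, inner_add_right, inner_smul_right, inner_smul_right]
    have e3 : inner ℝ (h + δ • k) (F (Q t)) - inner ℝ h (F (P t)) - (δ * inner ℝ k (F (P t)) +
        δ * t * inner ℝ k (A (h + (inner ℝ h (F (P t)) : ℝ) • e)))
        = inner ℝ h (A e) * D t + -(δ * t * curvature e A (F (P t)) h k) +
          inner ℝ h (F (Q t) - F (P t) - A (Q t - P t)) +
          δ * inner ℝ k (F (Q t) - F (P t)) := by
      rw [curvature, inner_sub_right h _ (A (Q t - P t)), e2, inner_sub_right, inner_sub_right,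
        inner_add_left, inner_smul_left]
      simp only [RCLike.conj_to_real]
      ring
    have hd := hQP t ht
    have b1 : ‖inner ℝ h (A e) * D t‖ ≤ ‖h‖ * K * ‖D t‖ := by
      rw [norm_mul]
      gcongr
      refine (norm_inner_le_norm _ _).trans ?_
      gcongr
      refine (A.le_opNorm e).trans ?_
      rwa [he, mul_one]
    have b2 : ‖-(δ * t * curvature e A (F (P t)) h k)‖ ≤ δ * κ := by
      rw [norm_neg, norm_mul, Real.norm_of_nonneg (mul_nonneg hδ.le ht.1)]
      exact mul_le_mul (mul_le_of_le_one_right hδ.le ht.2) (hκ w hw0 hw t ht) (norm_nonneg _) hδ.le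
    have b3 : ‖(inner ℝ h (F (Q t) - F (P t) - A (Q t - P t)) : ℝ)‖ ≤ ‖h‖ * (η * (δ * C)) := by
      refine (norm_inner_le_norm _ _).trans ?_
      gcongr
      refine (htaylor (P t) (mem_image_of_mem P ht) (Q t) (hd.trans_lt h1)).trans ?_
      gcongr
    have b4 : ‖δ * inner ℝ k (F (Q t) - F (P t))‖ ≤ δ * (‖k‖ * (K * (δ * C))) := by
      rw [norm_mul, Real.norm_of_nonneg hδ.le]
      gcongr
      refine (norm_inner_le_norm _ _).trans ?_
      gcongr
      refine (hF.lipschitz.norm_sub_le _ _).trans ?_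
      gcongr
    rw [e3]
    refine (norm_add_le _ _).trans ((add_le_add ((norm_add_le _ _).trans
      (add_le_add ((norm_add_le _ _).trans (add_le_add b1 b2)) b3)) b4).trans_eq ?_)
    ring
  have hgron := norm_le_gronwallBound_of_norm_deriv_right_le (f := D) (δ := 0)
    (fun t ht => (hDd t ht).continuousWithinAt)
    (fun t ht => (hDd t ⟨ht.1, ht.2.le⟩).mono_of_mem_nhdsWithin
      (mem_of_superset (Icc_mem_nhdsGE ht.2) (Icc_subset_Icc_left ht.1)))
    (by simp [hD_def, hw0, hv0]) (fun t ht => hbound t ⟨ht.1, ht.2.le⟩) 1 (by simp)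
  have hfin := hgron.trans (gronwallBound_le_mul_exp le_rfl (by positivity) (by positivity)
    (by simp))
  have hD1 : D 1 = transport F e b (h + δ • k) c - transport F e b h c
      - δ * inner ℝ k (F (b + h + transport F e b h c • e)) := by
    simp only [hD_def, hP_def, hv1, hw1, mul_one, one_smul]
  rw [hD1, Real.norm_eq_abs] at hfin
  refine hfin.trans ?_
  rw [zero_add, mul_assoc, mul_comm r]
  gcongr
  rw [← hX_def]
  linarith

/-- The estimate of `IsSlopeField.eventually_transport_sub_le`, integrated along a segment. -/
theorem IsSlopeField.abs_transport_sub_le_of_curvature {F : E → E} {e : E} {K : ℝ≥0} {M : ℝ}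
    (hF : IsSlopeField F e K M) (hF1 : ContDiff ℝ 1 F) {b h k : E} {c κ ρ : ℝ}
    (hh : ‖h‖ ≤ ρ) (hhk : ‖h + k‖ ≤ ρ)
    (hκ : ∀ h', ‖h'‖ ≤ ρ → ∀ w, w 0 = c → IsLift F e b h' w → ∀ t ∈ Icc (0 : ℝ) 1,
      |curvature e (fderiv ℝ F (b + t • h' + w t • e)) (F (b + t • h' + w t • e)) h' k| ≤ κ) :
    |transport F e b (h + k) c - transport F e b h c
        - inner ℝ k (F (b + h + transport F e b h c • e))| ≤
      κ * Real.exp (ρ * K) + K * (1 + (M + ρ * K) * Real.exp (ρ * K)) * ‖k‖ ^ 2 := by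
  have he := hF.norm_eq_one
  have hM0 := hF.bound_nonneg
  have hρ : 0 ≤ ρ := (norm_nonneg _).trans hh
  set T : E → ℝ := fun h => transport F e b h c with hT_def
  set N : E → E := fun h => b + h + T h • e with hN_def
  set X := Real.exp (ρ * K) with hX_def
  have hX : 0 < X := Real.exp_pos _
  have hκ0 : 0 ≤ κ := by
    obtain ⟨w, hw0, -, hw⟩ := hF.exists_lift b h c
    exact (abs_nonneg _).trans (hκ h hh w hw0 hw 0 (by simp))
  have hseg : ∀ s ∈ Icc (0 : ℝ) 1, ‖h + s • k‖ ≤ ρ := by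
    intro s hs
    have := (convex_closedBall (0 : E) ρ).add_smul_sub_mem (x := h) (y := h + k) (by simpa using hh)
      (by simpa using hhk) hs
    simpa using this
  have hlip : ∀ s ∈ Icc (0 : ℝ) 1, ‖N (h + s • k) - N h‖ ≤
      (1 + (M + ρ * K) * X) * ‖k‖ := by
    intro s hs
    have h1 := hF.abs_transport_sub_transport_le b b h (h + s • k) c c
    have h2 : ‖s • k‖ ≤ ‖k‖ := by
      rw [norm_smul, Real.norm_of_nonneg hs.1]
      exact mul_le_of_le_one_left (norm_nonneg _) hs.2
    rw [sub_self, abs_zero, zero_add, sub_self, norm_zero, zero_add, add_sub_cancel_left,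
      abs_sub_comm] at h1
    have e1 : N (h + s • k) - N h = s • k + (T (h + s • k) - T h) • e := by
      simp only [hN_def]; module
    rw [e1]
    refine (norm_add_le _ _).trans ?_
    rw [norm_smul (_ - _) e, he, mul_one, Real.norm_eq_abs]
    calc _ ≤ ‖k‖ + (‖k‖ * M + ρ * (K * ‖k‖)) * X := by
          refine add_le_add h2 (h1.trans ?_)
          gcongr
          exact Real.exp_le_exp.2 (by gcongr)
      _ = _ := by ring
  set y := F (N h) with hy_def
  set G : ℝ → ℝ := fun s => T (h + s • k) - T h - s * inner ℝ k y with hG_def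
  have hGc : Continuous G := by
    have h1 : Continuous fun s : ℝ => T (h + s • k) :=
      (hF.continuous_transport b).comp
        (by fun_prop : Continuous fun s : ℝ => ((h + s • k, c) : E × ℝ))
    exact (h1.sub continuous_const).sub (continuous_id.mul continuous_const)
  set B : ℝ := κ * X + K * (1 + (M + ρ * K) * X) * ‖k‖ ^ 2 with hB_def
  have key := image_le_of_liminf_slope_right_le_deriv_boundary (f := fun s => ‖G s‖) (a := 0)
    (b := 1) (B := fun s => s * B) (B' := fun _ => B) (hGc.norm.continuousOn)
    (by simp [hG_def]) (by fun_prop)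
    (fun s _ => by simpa using ((hasDerivAt_id s).mul_const B).hasDerivWithinAt) ?_
    (right_mem_Icc.2 zero_le_one)
  · simpa [hG_def, hN_def, hy_def] using key
  · intro s hs r hr
    have hs' : s ∈ Icc (0 : ℝ) 1 := ⟨hs.1, hs.2.le⟩
    obtain ⟨r', hr'1, hr'2⟩ : ∃ r', κ * X < r' ∧ r' + K * (1 + (M + ρ * K) * X) * ‖k‖ ^ 2 < r :=
      ⟨κ * X + (r - B) / 2, by linarith, by rw [hB_def] at *; linarith⟩
    have h1 := hF.eventually_transport_sub_le hF1 (k := k) (r := r') (hκ _ (hseg s hs'))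
      (lt_of_le_of_lt (mul_le_mul_of_nonneg_left (Real.exp_le_exp.2
        (mul_le_mul_of_nonneg_right (hseg s hs') K.coe_nonneg)) hκ0) hr'1)
    refine Eventually.frequently ?_
    filter_upwards [(tendsto_sub_nhdsGT s).eventually h1, self_mem_nhdsWithin] with z hz hsz
    have hsz : 0 < z - s := sub_pos.2 hsz
    rw [slope_def_field, div_lt_iff₀ hsz]
    have e1 : h + s • k + (z - s) • k = h + z • k := by module
    rw [e1] at hz
    have h2 : |G z - G s| ≤ r' * (z - s) + (z - s) * (K * (1 + (M + ρ * K) * X) * ‖k‖ ^ 2) := by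
      have e2 : G z - G s = (T (h + z • k) - T (h + s • k)
          - (z - s) * inner ℝ k (F (N (h + s • k)))) +
          (z - s) * inner ℝ k (F (N (h + s • k)) - y) := by
        simp only [hG_def, inner_sub_right]; ring
      rw [e2]
      refine (abs_add_le _ _).trans (add_le_add hz ?_)
      rw [abs_mul, abs_of_pos hsz]
      gcongr
      refine (abs_real_inner_le_norm _ _).trans ?_
      calc ‖k‖ * ‖F (N (h + s • k)) - y‖ ≤ ‖k‖ * (K * ((1 + (M + ρ * K) * X) * ‖k‖)) := by
            gcongr
            refine (hF.lipschitz.norm_sub_le _ _).trans ?_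
            gcongr
            exact hlip s hs'
        _ = _ := by ring
    have h3 := abs_norm_sub_norm_le (G z) (G s)
    have h4 := le_abs_self (‖G z‖ - ‖G s‖)
    have h5 := mul_lt_mul_of_pos_right hr'2 hsz
    rw [Real.norm_eq_abs (G z - G s)] at h3
    linarith

variable [FiniteDimensional ℝ E] [MeasurableSpace E] [BorelSpace E] {μ : Measure E}
  [μ.IsAddHaarMeasure]

/-- The theorem of Frobenius for a Lipschitz slope field whose curvature vanishes almost everywhere:
the leaves swept out by lifts of segments have the slope prescribed by the field. -/
theorem IsSlopeField.hasFDerivAt_transport {f : E → E} {e : E} {K : ℝ≥0} {M : ℝ}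
    (hf : IsSlopeField f e K M) {b : E} {R ρ : ℝ} (hR : 0 < R)
    (hcurv : ∀ᵐ p ∂μ, p ∈ Metric.ball b R → ∀ h k, curvature e (fderiv ℝ f p) (f p) h k = 0)
    (hρ : ρ * (2 + M) < R / 2) {h : E} {c : ℝ} (hh : ‖h‖ < ρ) (hc : |c| ≤ ρ) :
    HasFDerivAt (fun h => transport f e b h c)
      (innerSL ℝ (f (b + h + transport f e b h c • e))) h := by
  have he := hf.norm_eq_one
  have hM0 := hf.bound_nonneg
  have hρ0 : 0 ≤ ρ := (norm_nonneg _).trans hh.le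
  set C : ℝ := K * (1 + (M + ρ * K) * Real.exp (ρ * K)) with hC_def
  have main : ∀ k, ‖h + k‖ ≤ ρ → |transport f e b (h + k) c - transport f e b h c
        - inner ℝ k (f (b + h + transport f e b h c • e))| ≤ C * ‖k‖ ^ 2 := by
    intro k hhk
    set C' : ℝ := 4 * K ^ 2 * ρ * ‖k‖ * Real.exp (ρ * K) + 2 * (ρ * K * Real.exp (ρ * K)) +
      ‖k‖ * (K * (ρ * K * Real.exp (ρ * K)) + K) with hC'_def
    -- the estimate for a mollification of `f` at scale `ε`, with an error that vanishes with `ε`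
    have approx : ∀ ε ∈ Ioo 0 (R / 2), |transport f e b (h + k) c - transport f e b h c
        - inner ℝ k (f (b + h + transport f e b h c • e))| ≤ C * ‖k‖ ^ 2 + ε * C' := by
      intro ε hε
      obtain ⟨F, hF, hF1, hFf, hFcurv⟩ := hf.exists_smooth_approx hcurv hε.1
      have h1 := hF.abs_transport_sub_le_of_curvature hF1 (b := b) (h := h) (k := k) (c := c)
        (κ := 4 * K ^ 2 * ε * ρ * ‖k‖) hh.le hhk (fun h' hh' w hw0 hw t ht => by
          refine (hFcurv _ ?_ h' k).trans (by have := hε.1.le; gcongr)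
          have h2 := hw.abs_sub_initial_le hF.bound ht
          have h3 : |w t| ≤ ρ * M + ρ := by
            have := abs_sub_abs_le_abs_sub (w t) (w 0)
            rw [hw0] at this h2
            have := mul_le_mul_of_nonneg_right hh' hM0
            linarith
          rw [mem_ball_iff_norm, add_assoc, add_sub_cancel_left]
          have h4 : ‖t • h' + w t • e‖ ≤ ρ + (ρ * M + ρ) := by
            refine (norm_add_le _ _).trans (add_le_add ?_ ?_)
            · rw [norm_smul, Real.norm_of_nonneg ht.1]
              exact (mul_le_of_le_one_left (norm_nonneg _) ht.2).trans hh'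
            · rwa [norm_smul, he, mul_one]
          linarith [hε.2])
      have hdist : ∀ h', ‖h'‖ ≤ ρ → |transport f e b h' c - transport F e b h' c| ≤
          ρ * (K * ε) * Real.exp (ρ * K) := by
        intro h' hh'
        obtain ⟨w, h0, h1, hw⟩ := hf.exists_lift b h' c
        obtain ⟨v, h0', h1', hv⟩ := hF.exists_lift b h' c
        have := hw.abs_sub_le hf.lipschitz he hF.bound hFf hv (t := 1) (by simp)
        rw [h0, h1, h0', h1'] at this
        simp only [sub_self, abs_zero, norm_zero, zero_mul, zero_add, add_zero, mul_zero] at this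
        refine this.trans ?_
        have := hε.1.le
        gcongr
      have h2 := hdist h hh.le
      have h3 := hdist (h + k) hhk
      have h4 : |inner ℝ k (F (b + h + transport F e b h c • e))
          - inner ℝ k (f (b + h + transport f e b h c • e))| ≤
          ‖k‖ * (K * (ρ * (K * ε) * Real.exp (ρ * K)) + K * ε) := by
        rw [← inner_sub_right]
        refine (abs_real_inner_le_norm _ _).trans ?_
        gcongr
        refine (norm_sub_le_norm_sub_add_norm_sub _
          (F (b + h + transport f e b h c • e)) _).trans (add_le_add ?_ (hFf _))
        refine (hF.lipschitz.norm_sub_le _ _).trans ?_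
        gcongr
        rw [add_sub_add_left_eq_sub, ← sub_smul, norm_smul, he, mul_one, norm_sub_rev]
        exact h2
      rw [abs_le] at h1 h2 h3 h4 ⊢
      rw [hC'_def, hC_def]
      constructor <;> linarith
    have hlim : Tendsto (fun ε : ℝ => C * ‖k‖ ^ 2 + ε * C') (𝓝[>] 0) (𝓝 (C * ‖k‖ ^ 2 + 0 * C')) :=
      ((by fun_prop : Continuous fun ε : ℝ => C * ‖k‖ ^ 2 + ε * C').tendsto 0).mono_left
        nhdsWithin_le_nhds
    rw [zero_mul, add_zero] at hlim
    refine ge_of_tendsto hlim ?_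
    filter_upwards [Ioo_mem_nhdsGT (half_pos hR)] with ε hε using approx ε hε
  rw [hasFDerivAt_iff_isLittleO_nhds_zero]
  have hO : (fun k : E => transport f e b (h + k) c - transport f e b h c
      - innerSL ℝ (f (b + h + transport f e b h c • e)) k) =O[𝓝 0] fun k => ‖k‖ ^ 2 := by
    refine Asymptotics.IsBigO.of_bound C ?_
    have hnear : ∀ᶠ k : E in 𝓝 0, ‖h + k‖ < ρ :=
      (by fun_prop : ContinuousAt (fun k : E => ‖h + k‖) 0).eventually_lt_const (by simpa using hh)
    filter_upwards [hnear] with k hk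
    rw [innerSL_apply_apply, real_inner_comm, Real.norm_eq_abs, Real.norm_of_nonneg (by positivity)]
    exact main k hk.le
  exact hO.trans_isLittleO (Asymptotics.isLittleO_norm_pow_id one_lt_two)

end Frobenius

/-! ### Jacobi's condition and curvature -/

section Integrability

variable {n : ℕ}

local notation "𝔼" => EuclideanSpace ℝ (Fin n)

theorem eq_zero_of_forall_single (L : 𝔼 →ₗ[ℝ] ℝ)
    (h : ∀ i, L (EuclideanSpace.single i 1) = 0) (v : 𝔼) : L v = 0 := by
  have : L = 0 := (EuclideanSpace.basisFun (Fin n) ℝ).toBasis.ext fun i => by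
    simpa using h i
  rw [this, LinearMap.zero_apply]

/-- The coordinate-free form `g ∧ dg = 0` of Jacobi's condition, where `D` is the derivative and
`y` the value of `g`. -/
theorem wedge_eq_zero_of_jacobi (y : 𝔼) (D : 𝔼 →L[ℝ] 𝔼)
    (h : ∀ i j k : Fin n, y i * (D (EuclideanSpace.single k 1) j - D (EuclideanSpace.single j 1) k)
      + y j * (D (EuclideanSpace.single i 1) k - D (EuclideanSpace.single k 1) i)
      + y k * (D (EuclideanSpace.single j 1) i - D (EuclideanSpace.single i 1) j) = 0) (a b c : 𝔼) :
    inner ℝ y a * (inner ℝ b (D c) - inner ℝ c (D b))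
      + inner ℝ y b * (inner ℝ c (D a) - inner ℝ a (D c))
      + inner ℝ y c * (inner ℝ a (D b) - inner ℝ b (D a)) = 0 := by
  -- the expression is linear in each of `a`, `b`, `c`, so these may be taken to be basis vectors
  have lin : ∀ b c : 𝔼, ∃ L : 𝔼 →ₗ[ℝ] ℝ, ∀ a, L a =
      inner ℝ y a * (inner ℝ b (D c) - inner ℝ c (D b))
      + inner ℝ y b * (inner ℝ c (D a) - inner ℝ a (D c))
      + inner ℝ y c * (inner ℝ a (D b) - inner ℝ b (D a)) := fun b c =>
    ⟨IsLinearMap.mk' (fun a => inner ℝ y a * (inner ℝ b (D c) - inner ℝ c (D b))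
      + inner ℝ y b * (inner ℝ c (D a) - inner ℝ a (D c))
      + inner ℝ y c * (inner ℝ a (D b) - inner ℝ b (D a))) ⟨fun u v => by
        simp only [inner_add_right, inner_add_left, map_add]; ring,
      fun r u => by
        simp only [inner_smul_right, inner_smul_left, map_smul, RCLike.conj_to_real, smul_eq_mul]
        ring⟩, fun _ => rfl⟩
  have h1 : ∀ i j k : Fin n,
      inner ℝ y (EuclideanSpace.single i 1) * (inner ℝ (EuclideanSpace.single j 1)
        (D (EuclideanSpace.single k 1)) - inner ℝ (EuclideanSpace.single k 1)
          (D (EuclideanSpace.single j 1)))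
      + inner ℝ y (EuclideanSpace.single j 1) * (inner ℝ (EuclideanSpace.single k 1)
        (D (EuclideanSpace.single i 1)) - inner ℝ (EuclideanSpace.single i 1)
          (D (EuclideanSpace.single k 1)))
      + inner ℝ y (EuclideanSpace.single k 1) * (inner ℝ (EuclideanSpace.single i 1)
        (D (EuclideanSpace.single j 1)) - inner ℝ (EuclideanSpace.single j 1)
          (D (EuclideanSpace.single i 1))) = (0 : ℝ) := fun i j k => by
    simpa [EuclideanSpace.inner_single_left, EuclideanSpace.inner_single_right] using h i j k
  have h2 : ∀ (a : 𝔼) (j k : Fin n),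
      inner ℝ y a * (inner ℝ (EuclideanSpace.single j 1)
        (D (EuclideanSpace.single k 1)) - inner ℝ (EuclideanSpace.single k 1)
          (D (EuclideanSpace.single j 1)))
      + inner ℝ y (EuclideanSpace.single j 1) * (inner ℝ (EuclideanSpace.single k 1)
        (D a) - inner ℝ a (D (EuclideanSpace.single k 1)))
      + inner ℝ y (EuclideanSpace.single k 1) * (inner ℝ a
        (D (EuclideanSpace.single j 1)) - inner ℝ (EuclideanSpace.single j 1)
          (D a)) = (0 : ℝ) := fun a j k => by
    obtain ⟨L, hL⟩ := lin (EuclideanSpace.single j 1) (EuclideanSpace.single k 1)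
    rw [← hL]
    exact eq_zero_of_forall_single L (fun i => by rw [hL]; exact h1 i j k) a
  have h3 : ∀ (a b : 𝔼) (k : Fin n),
      inner ℝ y a * (inner ℝ b (D (EuclideanSpace.single k 1))
        - inner ℝ (EuclideanSpace.single k 1) (D b))
      + inner ℝ y b * (inner ℝ (EuclideanSpace.single k 1)
        (D a) - inner ℝ a (D (EuclideanSpace.single k 1)))
      + inner ℝ y (EuclideanSpace.single k 1) * (inner ℝ a (D b) - inner ℝ b (D a)) = (0 : ℝ) :=
    fun a b k => by
      obtain ⟨L, hL⟩ := lin (EuclideanSpace.single k 1) a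
      have := eq_zero_of_forall_single L (fun j => by rw [hL]; linarith [h2 a j k]) b
      rw [hL] at this
      linarith
  obtain ⟨L, hL⟩ := lin a b
  have := eq_zero_of_forall_single L (fun k => by rw [hL]; linarith [h3 a b k]) c
  rw [hL] at this
  linarith

/-- The curvature of the slope field `-g / ⟪e, g⟫` is a multiple of `(g ∧ dg) (e, h, k)`. -/
theorem curvature_eq_zero {f g : 𝔼 → 𝔼} {e x : 𝔼}
    (hfg : ∀ᶠ p in 𝓝 x, f p = -(inner ℝ e (g p))⁻¹ • g p) (hne : inner ℝ e (g x) ≠ 0)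
    {D : 𝔼 →L[ℝ] 𝔼} (hD : HasFDerivAt g D x)
    (hJ : ∀ a b c : 𝔼, inner ℝ (g x) a * (inner ℝ b (D c) - inner ℝ c (D b))
      + inner ℝ (g x) b * (inner ℝ c (D a) - inner ℝ a (D c))
      + inner ℝ (g x) c * (inner ℝ a (D b) - inner ℝ b (D a)) = 0) (h k : 𝔼) :
    curvature e (fderiv ℝ f x) (f x) h k = 0 := by
  set β : ℝ := inner ℝ e (g x) with hβ
  have h1 : HasFDerivAt (fun p => (inner ℝ e (g p) : ℝ)) ((innerSL ℝ e).comp D) x :=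
    (innerSL ℝ e).hasFDerivAt.comp x hD
  have h2 := ((hasDerivAt_inv hne).comp_hasFDerivAt x h1).fun_neg.fun_smul hD
  have h3 := h2.congr_of_eventuallyEq hfg
  have h4 : ∀ v, fderiv ℝ f x v = -β⁻¹ • D v + ((β ^ 2)⁻¹ * inner ℝ e (D v)) • g x := fun v => by
    rw [h3.fderiv]
    simp [← hβ]
  rw [curvature, h4, h4, hfg.self_of_nhds, ← hβ]
  have h5 := hJ e h k
  simp only [map_add, map_smul, inner_add_right, inner_smul_right]
  rw [real_inner_comm e (g x), ← hβ] at h5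
  rw [real_inner_comm (g x) h, real_inner_comm (g x) k]
  field_simp
  linear_combination β * h5

end Integrability

/-! ### Leaves of a slope field -/

section Leaves

variable {E : Type*} [NormedAddCommGroup E] [InnerProductSpace ℝ E] {f : E → E} {e x₀ : E}
  {K : ℝ≥0} {M : ℝ}

/-- The signed height, along `e`, of the leaf through `x₀ + c • e` above the point `p`. -/
noncomputable def leafHeight (f : E → E) (e x₀ : E) (c : ℝ) (p : E) : ℝ :=
  transport f e x₀ (p - x₀) c

/-- The height at which the leaf through `p` meets the line through `x₀` in direction `e`. -/
noncomputable def leafValue (f : E → E) (e x₀ p : E) : ℝ :=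
  transport f e p (x₀ - p) 0

theorem IsSlopeField.leafHeight_eq_zero_iff (hf : IsSlopeField f e K M) {c : ℝ} {p : E} :
    leafHeight f e x₀ c p = 0 ↔ leafValue f e x₀ p = c := by
  have h1 := hf.transport_reverse x₀ (p - x₀) c
  have h2 := hf.transport_reverse' x₀ (p - x₀) 0
  rw [add_sub_cancel, neg_sub] at h1 h2
  constructor
  · intro h
    rw [leafHeight] at h
    rwa [h] at h1
  · rintro rfl
    exact h2

theorem IsSlopeField.leafHeight_leafValue (hf : IsSlopeField f e K M) (p : E) :
    leafHeight f e x₀ (leafValue f e x₀ p) p = 0 :=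
  hf.leafHeight_eq_zero_iff.2 rfl

/-- The leaf value of `p` exceeds `c` when `p` lies above the leaf through `x₀ + c • e`. -/
theorem IsSlopeField.lt_leafValue_iff (hf : IsSlopeField f e K M) {c : ℝ} {p : E} :
    c < leafValue f e x₀ p ↔ leafHeight f e x₀ c p < 0 := by
  rw [← hf.leafHeight_leafValue (x₀ := x₀) p]
  exact ((hf.strictMono_transport x₀ (p - x₀)).lt_iff_lt).symm

theorem IsSlopeField.leafHeight_add_smul (hf : IsSlopeField f e K M) (c t : ℝ) (p : E) :
    leafHeight f e x₀ c (p + t • e) = leafHeight f e x₀ c p - t := by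
  rw [leafHeight, leafHeight, ← hf.transport_add_smul]
  congr 1
  abel

theorem IsSlopeField.abs_leafValue_le (hf : IsSlopeField f e K M) (p : E) :
    |leafValue f e x₀ p| ≤ ‖p - x₀‖ * M := by
  have := hf.abs_transport_sub_le p (x₀ - p) 0
  rwa [sub_zero, norm_sub_rev] at this

theorem IsSlopeField.continuous_leafHeight (hf : IsSlopeField f e K M) :
    Continuous fun x : ℝ × E => leafHeight f e x₀ x.1 x.2 :=
  (hf.continuous_transport x₀).comp
    (by fun_prop : Continuous fun x : ℝ × E => ((x.2 - x₀, x.1) : E × ℝ))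

theorem IsSlopeField.lipschitzOnWith_leafValue (hf : IsSlopeField f e K M) {r : ℝ} (hr : 0 ≤ r) :
    ∃ L : ℝ≥0, LipschitzOnWith L (leafValue f e x₀) (Metric.ball x₀ r) := by
  have hM0 := hf.bound_nonneg
  refine ⟨((M + r * (K * 2)) * Real.exp (r * K)).toNNReal,
    LipschitzOnWith.of_dist_le_mul fun p hp q _ => ?_⟩
  rw [Real.coe_toNNReal _ (by positivity), Real.dist_eq]
  have h1 := hf.abs_transport_sub_transport_le p q (x₀ - p) (x₀ - q) 0 0
  have h2 : ‖x₀ - p‖ ≤ r := by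
    rw [norm_sub_rev]; exact (mem_ball_iff_norm.1 hp).le
  have e1 : ‖x₀ - q - (x₀ - p)‖ = dist p q := by rw [dist_eq_norm]; congr 1; abel
  have e2 : ‖q - p‖ = dist p q := by rw [dist_comm, dist_eq_norm]
  rw [e1, e2, sub_self, abs_zero, zero_add] at h1
  refine h1.trans ?_
  calc _ ≤ (dist p q * M + r * (K * (dist p q + dist p q))) * Real.exp (r * K) := by
        gcongr
    _ = _ := by ring

/-- The leaf value grows at least linearly along `e`, so that its gradient cannot vanish. -/
theorem IsSlopeField.abs_le_abs_leafValue_sub_mul (hf : IsSlopeField f e K M) (p : E) (t : ℝ) :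
    |t| ≤ |leafValue f e x₀ (p + t • e) - leafValue f e x₀ p| *
      Real.exp (‖p + t • e - x₀‖ * K) := by
  have h1 := hf.abs_transport_sub_transport_le x₀ x₀ (p + t • e - x₀) (p + t • e - x₀)
    (leafValue f e x₀ (p + t • e)) (leafValue f e x₀ p)
  have h2 := hf.leafHeight_leafValue (x₀ := x₀) (p + t • e)
  have h3 := hf.leafHeight_add_smul (x₀ := x₀) (leafValue f e x₀ p) t p
  rw [hf.leafHeight_leafValue] at h3
  change |leafHeight f e x₀ _ _ - leafHeight f e x₀ _ _| ≤ _ at h1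
  rw [h2, h3] at h1
  simpa using h1

end Leaves

/-! ### Construction of regular solutions -/

section Construction

variable {n : ℕ}

local notation "𝔼" => EuclideanSpace ℝ (Fin n)

/-- Linear coordinates on the hyperplane orthogonal to a unit vector. -/
theorem exists_orthogonal_coordinates {e : 𝔼} (he : ‖e‖ = 1) :
    ∃ (I : EuclideanSpace ℝ (Fin (n - 1)) →L[ℝ] 𝔼) (P : 𝔼 →L[ℝ] EuclideanSpace ℝ (Fin (n - 1))),
      (∀ y, P (I y) = y) ∧ P e = 0 ∧ (∀ p, I (P p) = p - (inner ℝ e p : ℝ) • e) ∧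
        ∀ p, ‖I (P p)‖ ≤ ‖p‖ := by
  have he0 : e ≠ 0 := by
    rintro rfl
    simp at he
  set H : Submodule ℝ 𝔼 := (ℝ ∙ e)ᗮ with hH
  have hfin : Module.finrank ℝ H = n - 1 := by
    have := Submodule.finrank_add_finrank_orthogonal (ℝ ∙ e)
    rw [finrank_span_singleton he0, finrank_euclideanSpace_fin, ← hH] at this
    omega
  let B := ((stdOrthonormalBasis ℝ H).reindex (finCongr hfin)).repr
  let I : EuclideanSpace ℝ (Fin (n - 1)) →L[ℝ] 𝔼 :=
    H.subtypeL.comp B.symm.toContinuousLinearEquiv.toContinuousLinearMap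
  let P : 𝔼 →L[ℝ] EuclideanSpace ℝ (Fin (n - 1)) :=
    B.toContinuousLinearEquiv.toContinuousLinearMap.comp H.orthogonalProjectionOnto
  have hIP : ∀ p, I (P p) = H.starProjection p := fun p => by
    simp [I, P]
  refine ⟨I, P, fun y => by simp [I, P], ?_, fun p => ?_, fun p => ?_⟩
  · have : H.orthogonalProjectionOnto e = 0 :=
      Submodule.orthogonalProjectionOnto_apply_of_mem_orthogonal (by
        rw [hH, Submodule.orthogonal_orthogonal]
        exact Submodule.mem_span_singleton_self e)
    simp [P, this]
  · rw [hIP]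
    refine (Submodule.starProjection_orthogonal_val p).trans ?_
    rw [Submodule.starProjection_unit_singleton ℝ he]
  · rw [hIP]
    exact H.norm_starProjection_apply_le p

theorem contDiffOn_one_of_hasFDerivAt {E F : Type*} [NormedAddCommGroup E] [NormedSpace ℝ E]
    [NormedAddCommGroup F] [NormedSpace ℝ F] {f : E → F} {f' : E → E →L[ℝ] F} {s : Set E}
    (hs : IsOpen s) (h : ∀ x ∈ s, HasFDerivAt f (f' x) x) (hf' : ContinuousOn f' s) :
    ContDiffOn ℝ 1 f s := by
  rw [show (1 : WithTop ℕ∞) = 0 + 1 from (zero_add 1).symm, contDiffOn_succ_iff_fderiv_of_isOpen hs]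
  refine ⟨fun x hx => (h x hx).differentiableAt.differentiableWithinAt, by simp, ?_⟩
  exact contDiffOn_zero.2 (hf'.congr fun x hx => (h x hx).fderiv)

/-- Near each point, the height at which the leaf through a point meets a fixed transversal line is
a regular solution. -/
theorem IsSlopeField.isRegularSolution_leafValue {U : Set 𝔼} {g f : 𝔼 → 𝔼} {e x₀ : 𝔼} {K : ℝ≥0}
    {M ρ δ : ℝ} (hf : IsSlopeField f e K M) (hU : Metric.ball x₀ ρ ⊆ U) (hδ : 0 < δ)
    (hδρ : δ * (1 + M) ≤ ρ)
    (hg : ∀ p ∈ Metric.ball x₀ δ, 0 < inner ℝ e (g p) ∧ f p = -(inner ℝ e (g p))⁻¹ • g p)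
    (hgrad : ∀ p ∈ Metric.ball x₀ ρ, ∀ c : ℝ, |c| ≤ ρ → HasFDerivAt (leafHeight f e x₀ c)
      (innerSL ℝ (f (p + leafHeight f e x₀ c p • e))) p) :
    IsRegularSolution U g (Metric.ball x₀ δ) (leafValue f e x₀) := by
  have he := hf.norm_eq_one
  have hM0 := hf.bound_nonneg
  have hδρ' : δ ≤ ρ := by nlinarith
  have hball : Metric.ball x₀ δ ⊆ Metric.ball x₀ ρ := Metric.ball_subset_ball hδρ'
  set V := Metric.ball x₀ δ with hV_def
  have hV : IsOpen V := Metric.isOpen_ball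
  set u := leafValue f e x₀ with hu_def
  set W := leafHeight f e x₀ with hW_def
  have hub : ∀ p ∈ V, |u p| ≤ ρ := fun p hp => by
    refine (hf.abs_leafValue_le p).trans ?_
    have := mul_le_mul_of_nonneg_right (mem_ball_iff_norm.1 hp).le hM0
    linarith
  have hWz : ∀ {p c}, W c p = 0 ↔ u p = c := hf.leafHeight_eq_zero_iff
  have hWu : ∀ {p c}, c < u p ↔ W c p < 0 := hf.lt_leafValue_iff
  have hWc : Continuous fun x : ℝ × 𝔼 => W x.1 x.2 := hf.continuous_leafHeight
  have hWd : ∀ p ∈ V, HasFDerivAt (W (u p)) (innerSL ℝ (f p)) p := fun p hp => by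
    have := hgrad p (hball hp) (u p) (hub p hp)
    rwa [hWz.2 rfl, zero_smul, add_zero] at this
  have hgne : ∀ p ∈ V, g p ≠ 0 := fun p hp h0 => by
    have := (hg p hp).1
    rw [h0, inner_zero_right] at this
    exact lt_irrefl _ this
  obtain ⟨L, hL⟩ := hf.lipschitzOnWith_leafValue (x₀ := x₀) hδ.le
  have huc : ContinuousOn u V := hL.continuousOn
  have hinc : ∀ x ∈ V, ∃ ε : ℝ, 0 < ε ∧ (∀ t ∈ Ioo (-ε) ε, x + t • g x ∈ V) ∧
      StrictMonoOn (fun t : ℝ => u (x + t • g x)) (Ioo (-ε) ε) := by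
    intro x hx
    have hline : Continuous fun t : ℝ => x + t • g x := by fun_prop
    have hV0 : ∀ᶠ t : ℝ in 𝓝 0, x + t • g x ∈ V :=
      hline.continuousAt.eventually (hV.mem_nhds (by simpa using hx))
    have huc0 : ContinuousAt (fun t : ℝ => u (x + t • g x)) 0 := by
      have : ContinuousAt u (x + (0 : ℝ) • g x) := by
        simpa using huc.continuousAt (hV.mem_nhds hx)
      exact ContinuousAt.comp (f := fun t : ℝ => x + t • g x) this hline.continuousAt
    have hcont : ContinuousAt (fun z : ℝ × ℝ => (inner ℝ (f (x + z.2 • g x +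
        W (u (x + z.1 • g x)) (x + z.2 • g x) • e)) (g x) : ℝ)) (0, 0) := by
      have h1 : ContinuousAt (fun z : ℝ × ℝ => W (u (x + z.1 • g x)) (x + z.2 • g x)) (0, 0) := by
        have h2 : ContinuousAt (fun z : ℝ × ℝ => u (x + z.1 • g x)) (0, 0) :=
          ContinuousAt.comp (f := Prod.fst) (g := fun t : ℝ => u (x + t • g x)) huc0
            continuousAt_fst
        have h3 : ContinuousAt (fun z : ℝ × ℝ => x + z.2 • g x) (0, 0) := by fun_prop
        exact hWc.continuousAt.comp (h2.prodMk h3)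
      have h4 : ContinuousAt (fun z : ℝ × ℝ => x + z.2 • g x +
          W (u (x + z.1 • g x)) (x + z.2 • g x) • e) (0, 0) :=
        ContinuousAt.add (by fun_prop) (h1.smul continuousAt_const)
      exact (hf.lipschitz.continuous.continuousAt.comp h4).inner continuousAt_const
    have hneg : ∀ᶠ z : ℝ × ℝ in 𝓝 (0, 0), inner ℝ (f (x + z.2 • g x +
        W (u (x + z.1 • g x)) (x + z.2 • g x) • e)) (g x) < 0 := by
      refine hcont.eventually_lt_const ?_
      simp only [zero_smul, add_zero]
      rw [hWz.2 rfl, zero_smul, add_zero, (hg x hx).2, inner_smul_left]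
      have h1 := inv_pos.2 (hg x hx).1
      have h2 : 0 < inner ℝ (g x) (g x) := real_inner_self_pos.2 (hgne x hx)
      have h3 := mul_pos h1 h2
      simp only [RCLike.conj_to_real]
      linarith
    rw [nhds_prod_eq] at hneg
    obtain ⟨A, hA, B, hB, hAB⟩ := Filter.eventually_prod_iff.1 hneg
    obtain ⟨ε, hε, hall⟩ := Metric.eventually_nhds_iff_ball.1 ((hA.and hB).and hV0)
    rw [Real.ball_eq_Ioo, zero_sub, zero_add] at hall
    refine ⟨ε, hε, fun t ht => (hall t ht).2, fun t₁ ht₁ t₂ ht₂ h12 => ?_⟩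
    simp only
    set c := u (x + t₁ • g x) with hc
    rw [hWu]
    have hsub : Icc t₁ t₂ ⊆ Ioo (-ε) ε := fun s hs => ⟨ht₁.1.trans_le hs.1, hs.2.trans_lt ht₂.2⟩
    -- along `g x`, the height of the leaf through `x + t₁ • g x` decreases, so the curve rises above
    -- that leaf
    have hder : ∀ s ∈ Icc t₁ t₂, HasDerivAt (fun s => W c (x + s • g x))
        (inner ℝ (f (x + s • g x + W c (x + s • g x) • e)) (g x)) s := by
      intro s hs
      have h1 := hgrad _ (hball (hall s (hsub hs)).2) c (hub _ (hall t₁ ht₁).2)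
      have h2 : HasDerivAt (fun s : ℝ => x + s • g x) (g x) s := by
        simpa using ((hasDerivAt_id s).smul_const (g x)).const_add x
      exact h1.comp_hasDerivAt s h2
    have hanti : StrictAntiOn (fun s => W c (x + s • g x)) (Icc t₁ t₂) := by
      refine strictAntiOn_of_deriv_neg (convex_Icc _ _)
        (fun s hs => (hder s hs).continuousAt.continuousWithinAt) fun s hs => ?_
      have hs := interior_subset hs
      rw [(hder s hs).deriv]
      exact hAB (hall t₁ ht₁).1.1 (hall s (hsub hs)).1.2
    have := hanti (left_mem_Icc.2 h12.le) (right_mem_Icc.2 h12.le) h12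
    simp only at this
    rwa [hWz.2 hc.symm] at this
  have hleaf : ∀ c : ℝ, ∀ x ∈ {x ∈ V | u x = c}, |c| ≤ ρ := by
    rintro c x ⟨hx, rfl⟩
    exact hub x hx
  obtain ⟨I, P, hPI, hPe, hIP, hIPle⟩ := exists_orthogonal_coordinates he
  have hIle : ∀ (y) (t : ℝ), ‖I y‖ ≤ ‖I y + t • e‖ := fun y t => by
    have := hIPle (I y + t • e)
    rwa [map_add, map_smul, hPe, smul_zero, add_zero, hPI] at this
  refine { isOpen := hV, subset := hball.trans hU, locallyLipschitz := ?_, level_manifold := ?_,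
           level_normal := ?_, no_localMax := ?_, no_localMin := ?_, gradient_ne_zero := ?_,
           isConnected := ?_, increasing := hinc }
  · exact fun x _ => ⟨L, V, self_mem_nhdsWithin, hL⟩
  · intro c x hx
    have hcρ := hleaf c x hx
    -- the leaf is the graph of its height over the hyperplane orthogonal to `e`
    set φ : EuclideanSpace ℝ (Fin (n - 1)) → 𝔼 := fun y => x₀ + I y + W c (x₀ + I y) • e with hφ
    set ψ : 𝔼 → EuclideanSpace ℝ (Fin (n - 1)) := fun p => P (p - x₀) with hψ
    have hφc : Continuous φ := by
      have h1 : Continuous fun y => W c (x₀ + I y) :=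
        hWc.comp (by fun_prop : Continuous fun y => ((c, x₀ + I y) : ℝ × 𝔼))
      exact (continuous_const.add I.continuous).add (h1.smul continuous_const)
    have hφV : ∀ y, φ y ∈ V → x₀ + I y ∈ Metric.ball x₀ ρ := fun y hy => by
      rw [mem_ball_iff_norm, add_sub_cancel_left]
      refine (hIle y (W c (x₀ + I y))).trans_lt (lt_of_lt_of_le ?_ hδρ')
      rw [hV_def, mem_ball_iff_norm, hφ] at hy
      simpa [add_assoc] using hy
    have hφu : ∀ y, u (φ y) = c := fun y => by
      rw [← hWz, hφ, hW_def, hf.leafHeight_add_smul, sub_self]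
    have hψφ : ∀ y, ψ (φ y) = y := fun y => by
      simp only [hφ, hψ]
      rw [add_assoc, add_sub_cancel_left, map_add, map_smul, hPe, smul_zero, add_zero, hPI]
    have hφψ : ∀ p, u p = c → φ (ψ p) = p := fun p hp => by
      have h1 : x₀ + I (ψ p) = p + (-(inner ℝ e (p - x₀) : ℝ)) • e := by
        rw [hψ, hIP]; module
      have h2 : W c (x₀ + I (ψ p)) = inner ℝ e (p - x₀) := by
        rw [h1, hW_def, hf.leafHeight_add_smul, ← hW_def, hWz.2 hp, zero_sub, neg_neg]
      simp only [hφ]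
      rw [h2, h1]
      module
    refine ⟨φ ⁻¹' V, φ, hV.preimage hφc, V, hV, ⟨hx, hx.1⟩, ?_, ψ, ?_, ?_, ⟨?_, ?_⟩, ?_⟩
    · intro y hy
      obtain ⟨r, hr, hry⟩ := Metric.isOpen_iff.1 (hV.preimage hφc) y hy
      refine ⟨r, hr, φ, ContDiffOn.mono ?_ hry, fun _ _ => rfl⟩
      have hWC : ContDiffOn ℝ 1 (W c) (Metric.ball x₀ ρ) := by
        refine contDiffOn_one_of_hasFDerivAt Metric.isOpen_ball (fun p hp => hgrad p hp c hcρ) ?_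
        refine Continuous.continuousOn ?_
        have h1 : Continuous (W c) := hWc.comp (by fun_prop : Continuous fun p => ((c, p) : ℝ × 𝔼))
        exact (innerSL ℝ).continuous.comp (hf.lipschitz.continuous.comp
          (continuous_id.add (h1.smul continuous_const)))
      have hlin : ContDiff ℝ 1 fun y => x₀ + I y := contDiff_const.add I.contDiff
      exact hlin.contDiffOn.add ((hWC.comp hlin.contDiffOn fun y hy => hφV y hy).smul
        contDiffOn_const)
    · exact fun y hy => ⟨⟨hy, hφu y⟩, hy⟩
    · exact fun p hp => by rw [mem_preimage, hφψ p hp.1.2]; exact hp.2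
    · exact fun y _ => hψφ y
    · exact fun p hp => hφψ p hp.1.2
    · intro p _
      have : ContDiff ℝ 1 ψ := P.contDiff.comp (contDiff_id.sub contDiff_const)
      exact ⟨1, one_pos, ψ, this.contDiffOn, fun _ _ => rfl⟩
  · rintro c x hx v ⟨S, φ, ⟨hS, O, hO, hxO, hφ1, ψ, hmφ, -⟩, w, hw, hφw, a, rfl⟩
    have hφd : DifferentiableAt ℝ φ w := hφ1.differentiableAt (hS.mem_nhds hw)
    have h1 : HasFDerivAt (W c) (innerSL ℝ (f x)) (φ w) := by
      have := hWd x hx.1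
      rw [hφw]
      rwa [hx.2] at this
    have h2 := h1.comp w hφd.hasFDerivAt
    have h3 : HasFDerivAt (W c ∘ φ) (0 : EuclideanSpace ℝ (Fin (n - 1)) →L[ℝ] ℝ) w := by
      refine (hasFDerivAt_const (0 : ℝ) w).congr_of_eventuallyEq ?_
      filter_upwards [hS.mem_nhds hw] with y hy
      exact hWz.2 (hmφ hy).1.2
    have h4 := congrArg (fun T => T a) (h2.unique h3)
    simp only [ContinuousLinearMap.comp_apply, innerSL_apply_apply,
      zero_apply] at h4
    obtain ⟨h5, h6⟩ := hg x hx.1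
    rw [h6, inner_smul_left] at h4
    exact (mul_eq_zero.1 h4).resolve_left (by simpa using h5.ne')
  · intro x hx hmax
    obtain ⟨ε, hε, hεV, hmono⟩ := hinc x hx
    have h1 : ContinuousAt (fun t : ℝ => x + t • g x) 0 := by fun_prop
    have h2 : ∀ᶠ y in 𝓝 x, y ∈ V → u y ≤ u x := eventually_nhdsWithin_iff.1 hmax
    have h3 : ∀ᶠ t : ℝ in 𝓝 0, x + t • g x ∈ V → u (x + t • g x) ≤ u x :=
      h1.eventually (by simpa using h2)
    obtain ⟨t, h4, h5⟩ := ((h3.filter_mono nhdsWithin_le_nhds).and (Ioo_mem_nhdsGT hε)).exists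
    have ht : t ∈ Ioo (-ε) ε := ⟨by linarith [h5.1], h5.2⟩
    have h6 := hmono (a := 0) ⟨by linarith, hε⟩ ht h5.1
    simp only [zero_smul, add_zero] at h6
    exact absurd (h4 (hεV t ht)) (not_le.2 h6)
  · intro x hx hmin
    obtain ⟨ε, hε, hεV, hmono⟩ := hinc x hx
    have h1 : ContinuousAt (fun t : ℝ => x + t • g x) 0 := by fun_prop
    have h2 : ∀ᶠ y in 𝓝 x, y ∈ V → u x ≤ u y := eventually_nhdsWithin_iff.1 hmin
    have h3 : ∀ᶠ t : ℝ in 𝓝 0, x + t • g x ∈ V → u x ≤ u (x + t • g x) :=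
      h1.eventually (by simpa using h2)
    obtain ⟨t, h4, h5⟩ := ((h3.filter_mono nhdsWithin_le_nhds).and
      (Ioo_mem_nhdsLT (neg_lt_zero.2 hε))).exists
    have ht : t ∈ Ioo (-ε) ε := ⟨h5.1, by linarith [h5.2]⟩
    have h6 := hmono ht (b := 0) ⟨by linarith, hε⟩ h5.2
    simp only [zero_smul, add_zero] at h6
    exact absurd (h4 (hεV t ht)) (not_le.2 h6)
  · intro x hx hdiff h0
    have hfd : HasFDerivAt u (0 : 𝔼 →L[ℝ] ℝ) x := by
      have h1 : HasGradientAt u (gradient u x) x := hdiff.hasGradientAt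
      rw [h0] at h1
      simpa [HasGradientAt] using h1.hasFDerivAt
    have hline : HasDerivAt (fun t : ℝ => x + t • e) e 0 := by
      simpa using ((hasDerivAt_id (0 : ℝ)).smul_const e).const_add x
    have hfd' : HasFDerivAt u (0 : 𝔼 →L[ℝ] ℝ) (x + (0 : ℝ) • e) := by simpa using hfd
    have hd : HasDerivAt (fun t : ℝ => u (x + t • e)) 0 0 := by
      exact hfd'.comp_hasDerivAt 0 hline
    set X := Real.exp (ρ * K) with hX_def
    have hX : 0 < X := Real.exp_pos _
    have h1 := hd.isLittleO.def (c := (2 * X)⁻¹) (by positivity)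
    have h2 : ∀ᶠ t : ℝ in 𝓝 0, x + t • e ∈ V :=
      hline.continuousAt.eventually (hV.mem_nhds (by simpa using hx))
    obtain ⟨t, ⟨h3, h4⟩, h5⟩ := (((h1.filter_mono nhdsWithin_le_nhds).and
      (h2.filter_mono nhdsWithin_le_nhds)).and (self_mem_nhdsWithin (a := (0 : ℝ))
        (s := Ioi 0))).exists
    have h5 : 0 < t := h5
    have h6 := hf.abs_le_abs_leafValue_sub_mul (x₀ := x₀) x t
    have h7 : Real.exp (‖x + t • e - x₀‖ * K) ≤ X :=
      Real.exp_le_exp.2 (mul_le_mul_of_nonneg_right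
        (mem_ball_iff_norm.1 (hball h4)).le K.coe_nonneg)
    simp only [zero_smul, add_zero, smul_zero, sub_zero, Real.norm_eq_abs] at h3
    rw [abs_of_pos h5] at h3 h6
    have h8 : t ≤ (2 * X)⁻¹ * t * X := h6.trans (by
      refine (mul_le_mul h3 h7 (Real.exp_pos _).le (by positivity)).trans_eq rfl)
    have h9 : (2 * X)⁻¹ * t * X = t / 2 := by field_simp
    linarith
  · exact ⟨Metric.nonempty_ball.2 hδ, (convex_ball x₀ δ).isPreconnected⟩

/-- A nonvanishing locally Lipschitz field that satisfies Jacobi's condition has regular solutions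
on small balls around every point. -/
theorem exists_isRegularSolution {U : Set 𝔼} (hU : IsOpen U) {g : 𝔼 → 𝔼}
    (hg_ne : ∀ x ∈ U, g x ≠ 0) (hg : LocallyLipschitzOn U g) (hJ : JacobiCondition U g) {x₀ : 𝔼}
    (hx₀ : x₀ ∈ U) : ∃ (V : Set 𝔼) (u : 𝔼 → ℝ), x₀ ∈ V ∧ Convex ℝ V ∧ IsRegularSolution U g V u := by
  obtain ⟨f, e, K, M, r, m, hf, -, hr, hm, hrU, hfg⟩ :=
    exists_isSlopeField hU hg hx₀ (hg_ne x₀ hx₀)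
  have hM0 := hf.bound_nonneg
  obtain ⟨L, t, ht, hL⟩ := hg hx₀
  rw [hU.nhdsWithin_eq hx₀] at ht
  obtain ⟨r', hr', hr't⟩ := Metric.mem_nhds_iff.1 ht
  set R := min r r' with hR_def
  have hR : 0 < R := lt_min hr hr'
  have hLR : LipschitzOnWith L g (Metric.ball x₀ R) :=
    hL.mono ((Metric.ball_subset_ball (min_le_right _ _)).trans hr't)
  have hRr : Metric.ball x₀ R ⊆ Metric.ball x₀ r := Metric.ball_subset_ball (min_le_left _ _)
  have hcurv : ∀ᵐ p ∂volume, p ∈ Metric.ball x₀ R →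
      ∀ h k, curvature e (fderiv ℝ f p) (f p) h k = 0 := by
    have hJ' : ∀ᵐ p ∂volume, p ∈ U → ∀ i j k : Fin n,
        g p i * (partialD g j k p - partialD g k j p)
          + g p j * (partialD g k i p - partialD g i k p)
          + g p k * (partialD g i j p - partialD g j i p) = 0 := by
      refine (ae_restrict_iff' hU.measurableSet).1 ?_
      exact ae_all_iff.2 fun i => ae_all_iff.2 fun j => ae_all_iff.2 fun k => hJ i j k
    filter_upwards [hJ', hLR.ae_differentiableWithinAt_of_mem (μ := volume)] with p hpJ hpd hpR
    have hd : HasFDerivAt g (fderiv ℝ g p) p :=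
      ((hpd hpR).differentiableAt (Metric.isOpen_ball.mem_nhds hpR)).hasFDerivAt
    have hpart : ∀ j k : Fin n, partialD g j k p =
        fderiv ℝ g p (EuclideanSpace.single k 1) j := fun j k => by
      have h1 : HasFDerivAt (fun y => g y j) ((EuclideanSpace.proj j).comp (fderiv ℝ g p)) p :=
        (EuclideanSpace.proj (𝕜 := ℝ) j).hasFDerivAt.comp p hd
      exact (h1.hasLineDerivAt _).lineDeriv
    refine curvature_eq_zero ?_ (hm.trans_le (hfg p (hRr hpR)).1).ne' hd
      (wedge_eq_zero_of_jacobi _ _ fun i j k => ?_)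
    · filter_upwards [Metric.isOpen_ball.mem_nhds hpR] with q hq using (hfg q (hRr hq)).2
    · have := hpJ (hrU (hRr hpR)) i j k
      simpa only [hpart] using this
  have hpos : 0 < 2 + M := by linarith
  obtain ⟨ρ, hρ, hρR⟩ : ∃ ρ > 0, ρ * (2 + M) < R / 2 :=
    ⟨R / 4 / (2 + M), by positivity, by rw [div_mul_cancel₀ _ hpos.ne']; linarith⟩
  have hρR' : ρ ≤ R := by nlinarith
  have hδ : 0 < ρ / (1 + M) := by positivity
  refine ⟨Metric.ball x₀ (ρ / (1 + M)), leafValue f e x₀, Metric.mem_ball_self hδ,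
    convex_ball _ _, ?_⟩
  have hδρ : ρ / (1 + M) ≤ ρ := div_le_self hρ.le (by linarith)
  refine hf.isRegularSolution_leafValue (ρ := ρ) ?_ hδ ?_ (fun p hp => ?_) fun p hp c hc => ?_
  · exact (Metric.ball_subset_ball hρR').trans (hRr.trans hrU)
  · rw [div_mul_cancel₀ _ (by positivity)]
  · have := hfg p (hRr (Metric.ball_subset_ball (hδρ.trans hρR') hp))
    exact ⟨hm.trans_le this.1, this.2⟩
  · have h1 := hf.hasFDerivAt_transport hR hcurv hρR (h := p - x₀) (c := c)
      (mem_ball_iff_norm.1 hp) hc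
    have h2 := h1.comp p ((hasFDerivAt_id p).sub_const x₀)
    rw [add_sub_cancel] at h2
    exact h2

end Construction

end TotalDiff

theorem mainTheorem2 (n : ℕ) (U : Set (EuclideanSpace ℝ (Fin n))) (hU : IsOpen U)
    (g : EuclideanSpace ℝ (Fin n) → EuclideanSpace ℝ (Fin n))
    (hg_ne : ∀ x ∈ U, g x ≠ 0) (hg_lip : LocallyLipschitzOn U g)
    (hg_jacobi : TotalDiff.JacobiCondition U g) :
    List.TFAE [
      ∀ xs ∈ U, ∃ V : Set (EuclideanSpace ℝ (Fin n)), IsOpen V ∧ xs ∈ V ∧ V ⊆ U ∧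
        ∀ x ∈ V, ∀ y ∈ V, inner ℝ (g x) y ≥ inner ℝ (g x) x →
          inner ℝ (g y) x ≤ inner ℝ (g y) y,
      ∀ x ∈ U, ∀ v : EuclideanSpace ℝ (Fin n), inner ℝ (g x) v = 0 →
        0 ≤ limsup (fun t : ℝ => ((1 / t * inner ℝ v (g (x + t • v)) : ℝ) : EReal)) (𝓝[>] 0),
      ∀ (V : Set (EuclideanSpace ℝ (Fin n))) (u : EuclideanSpace ℝ (Fin n) → ℝ),
        Convex ℝ V → TotalDiff.IsRegularSolution U g V u → QuasiconvexOn ℝ V u] := by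
  tfae_have 1 → 2 := fun hi x hx v hv => TotalDiff.limsup_nonneg_of_local_pseudomonotone hi hx hv
  tfae_have 2 → 3 := fun hii V u hV hu => hu.quasiconvexOn hU hg_ne hg_lip hii hV
  tfae_have 3 → 1 := fun hiii xs hxs => by
    obtain ⟨V, u, hxV, hV, hu⟩ :=
      TotalDiff.exists_isRegularSolution hU hg_ne hg_lip hg_jacobi hxs
    exact ⟨V, hu.isOpen, hxV, hu.subset, fun x hx y hy hxy =>
      hu.inner_le_of_quasiconvexOn hU hg_ne hg_lip (hiii V u hV hu) hx hy hxy⟩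
  tfae_finish
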